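/- Let $R$ be a commutative ring with identity and let $C$ be a semidualizing $R$-module, i.e. $C$ has a resolution by finitely generated projective modules, the homothety map $R\to \mathrm{Hom}_R(C,C)$ is an isomorphism, and $\mathrm{Ext}_R^{i}(C,C)=0$ for all $i\ge 1$. **Notation.** Put $\mathcal P_C=\{C\otimes_R P : P \text{ projective}\}$, $\mathcal F_C=\{C\otimes_R F: F\text{ flat}\}$ and $\mathcal I_C=\{\mathrm{Hom}_R(C,I): I\text{ injective}\}$ (up to isomorphism). Let $\mathcal G(\mathcal W_F)$ be the class of modules $N\cong\mathrm{im}(W_0\to W^0)$ for some exact sequence $\cdots\to W_1\to W_0\to W^0\to W^1\to\cdots$ of modules in $\mathcal F_C$ that remains exact under $\mathrm{Hom}_R(V,-)$ for all $V\in\mathcal P_C$ and under $U\otimes_R-$ for all $U\in\mathcal I_C$. A module is Gorenstein flat if it is isomorphic to $\mathrm{im}(F_0\to F^0)$ for some exact sequence $\cdots\to F_1\to F_0\to F^0\to F^1\to\cdots$ of flat modules that remains exact under $I\otimes_R-$ for all injective $I$; $R$ is GF-closed if the class of Gorenstein flat modules is closed under extensions. For a class $\mathcal X$ of modules, $\mathcal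 X\text{-}\mathrm{pd}_R(N)$ is the infimum, over all exact sequences $\cdots\to X_1\to X_0\to N\to 0$ with all $X_k\in\mathcal X$, of $\sup\{k: X_k\ne 0\}$, and $\mathcal X\text{-}\mathrm{id}_R(N)$ is defined dually with exact sequences $0\to N\to X^0\to X^1\to\cdots$. Conventions: $\sup\emptyset=-\infty$ and $\inf\emptyset=+\infty$; thus the zero module has dimension $-\infty$ for each of the classes above, and $\mathcal X\text{-}\mathrm{pd}_R(N)\le -1$ means $N=0$. A dimension is called finite if it is $<+\infty$. **Theorem 3.8.** Let $R$ be GF-closed and let $M$ be an $R$-module with $\mathcal G(\mathcal W_F)\text{-}\mathrm{pd}_R(M)<\infty$. For every integer $n\ge 0$ the following are equivalent: 1. $\mathcal G(\mathcal W_F)\text{-}\mathrm{pd}_R(M)\le n$. 2. For every integer $t$ with $0\le t\le n$ there is an exact sequence $0\to W_n\to\cdots\to W_1\to W_0\to M\to 0$ with $W_t\in\mathcal G(\mathcal W_F)$ and $W_i\in\mathcal F_C$ for all $i\ne t$. 3. There is a short exact sequence $0\to K\to G\to M\to 0$ with $G\in\mathcal G(\mathcal W_F)$ and $\mathcal F_C\text{-}\mathrm{pd}_R(K)\le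 n-1$. 4. There is a short exact sequence $0\to M\to K'\to G'\to 0$ with $G'\in\mathcal G(\mathcal W_F)$ and $\mathcal F_C\text{-}\mathrm{pd}_R(K')\le n$. 5. There is an exact sequence $0\to G\to V_{n-1}\to\cdots\to V_0\to M\to 0$ with $G\in\mathcal G(\mathcal W_F)$ and $V_i\in\mathcal P_C$ for $0\le i\le n-1$. 6. For every exact sequence $0\to K_n\to G_{n-1}\to\cdots\to G_0\to M\to 0$ with $G_i\in\mathcal G(\mathcal W_F)$ for $0\le i\le n-1$, also $K_n\in\mathcal G(\mathcal W_F)$. 7. $\mathrm{Tor}^R_{n+j}(U,M)=0$ for all $j\ge 1$ and all $U\in\mathcal I_C$. 8. $\mathrm{Tor}^R_{n+j}(U,M)=0$ for all $j\ge 1$ and all $U$ with $\mathcal I_C\text{-}\mathrm{id}_R(U)<\infty$. (For $n=0$ the sequences in 5 and 6 are $0\to G\to M\to 0$ and $0\to K_0\to M\to 0$.) Furthermore, $$\mathcal G(\mathcal W_F)\text{-}\mathrm{pd}_R(M)=\sup\{n\in\mathbb N : \mathrm{Tor}^R_n(U,M)\ne 0\text{ for some }U\in\mathcal I_C\}$$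 $$=\sup\{n\in\mathbb N : \mathrm{Tor}^R_n(U,M)\ne 0\text{ for some }U\text{ with }\mathcal I_C\text{-}\mathrm{id}_R(U)<\infty\},$$ where $\mathbb N=\{0,1,2,\dots\}$. -/

import Mathlib

open CategoryTheory
open scoped TensorProduct

universe u

namespace WFGorenstein

/-! All rings are commutative. A class of modules is a predicate on `ModuleCat.{u} R`; every class
below is closed under isomorphism by its definition. -/

section Sequences

variable {R : Type u} [CommRing R]

/-- An exact sequence `⋯ → X 1 → X 0 → M → 0`. A finite exact sequence
`0 → X n → ⋯ → X 0 → M → 0` is one in which `X i` is zero for all `i > n`. -/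
structure LeftSeq (M : ModuleCat.{u} R) where
  X : ℕ → ModuleCat.{u} R
  d : ∀ n, X (n + 1) →ₗ[R] X n
  aug : X 0 →ₗ[R] M
  exact_d : ∀ n, Function.Exact (d (n + 1)) (d n)
  exact_aug : Function.Exact (d 0) aug
  surjective_aug : Function.Surjective aug

/-- An exact sequence `0 → M → X 0 → X 1 → ⋯`. -/
structure RightSeq (M : ModuleCat.{u} R) where
  X : ℕ → ModuleCat.{u} R
  d : ∀ n, X n →ₗ[R] X (n + 1)
  aug : M →ₗ[R] X 0
  injective_aug : Function.Injective aug
  exact_aug : Function.Exact aug (d 0)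
  exact_d : ∀ n, Function.Exact (d n) (d (n + 1))

/-- The `𝒳`-projective dimension: the infimum, over the left resolutions of `M` by modules in `𝒳`,
of `sup {n | X n ≠ 0}`. Here `sup ∅ = ⊥` (it plays the role of `-∞`) and `inf ∅ = ⊤`. -/
noncomputable def projDim (𝒳 : ModuleCat.{u} R → Prop) (M : ModuleCat.{u} R) : WithBot ℕ∞ :=
  ⨅ P : {P : LeftSeq M // ∀ n, 𝒳 (P.X n)},
    sSup {m : WithBot ℕ∞ | ∃ n : ℕ, Nontrivial (P.1.X n) ∧ m = n}

/-- The `𝒳`-injective dimension: the infimum, over the right resolutions of `M` by modules in `𝒳`,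
of `sup {n | X n ≠ 0}`. -/
noncomputable def injDim (𝒳 : ModuleCat.{u} R → Prop) (M : ModuleCat.{u} R) : WithBot ℕ∞ :=
  ⨅ P : {P : RightSeq M // ∀ n, 𝒳 (P.X n)},
    sSup {m : WithBot ℕ∞ | ∃ n : ℕ, Nontrivial (P.1.X n) ∧ m = n}

/-- `0 → A → B → D → 0` is exact. -/
def IsShortExact {A B D : ModuleCat.{u} R} (f : A →ₗ[R] B) (g : B →ₗ[R] D) : Prop :=
  Function.Injective f ∧ Function.Exact f g ∧ Function.Surjective g

/-- A two-sided exact sequence `⋯ → X (-1) → X 0 → X 1 → X 2 → ⋯`. -/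
structure ExactSeq (R : Type u) [CommRing R] where
  X : ℤ → ModuleCat.{u} R
  d : ∀ n, X n →ₗ[R] X (n + 1)
  exact_d : ∀ n, Function.Exact (d n) (d (n + 1))

/-- The sequence stays exact after applying `U ⊗ -`. -/
def ExactSeq.TensorExact (S : ExactSeq R) (U : ModuleCat.{u} R) : Prop :=
  ∀ n, Function.Exact ((S.d n).lTensor U) ((S.d (n + 1)).lTensor U)

/-- The sequence stays exact after applying `Hom(V, -)`. -/
def ExactSeq.HomExact (S : ExactSeq R) (V : ModuleCat.{u} R) : Prop :=
  ∀ n, Function.Exact (fun f : V →ₗ[R] S.X n => S.d n ∘ₗ f)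
    (fun f : V →ₗ[R] S.X (n + 1) => S.d (n + 1) ∘ₗ f)

end Sequences

section GorensteinFlat

variable {R : Type u} [CommRing R]

/-- `M` is Gorenstein flat: it is the image of `X 0 → X 1` in an exact sequence of flat modules that
stays exact under `I ⊗ -` for every injective `I`. -/
def IsGorensteinFlat (M : ModuleCat.{u} R) : Prop :=
  ∃ S : ExactSeq R, (∀ n, Module.Flat R (S.X n)) ∧
    Nonempty (M ≃ₗ[R] LinearMap.range (S.d 0)) ∧
    ∀ I : ModuleCat.{u} R, Module.Injective R I → S.TensorExact I

/-- `R` is GF-closed: the Gorenstein flat modules are closed under extensions. -/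
def IsGFClosed (R : Type u) [CommRing R] : Prop :=
  ∀ (A B D : ModuleCat.{u} R) (f : A →ₗ[R] B) (g : B →ₗ[R] D), IsShortExact f g →
    IsGorensteinFlat A → IsGorensteinFlat D → IsGorensteinFlat B

end GorensteinFlat

section Semidualizing

variable {R : Type u} [CommRing R]

/-- `C` is semidualizing: it has a degreewise finite projective resolution, the homothety map
`R → Hom(C, C)` is bijective, and `Ext^i(C, C) = 0` for all `i ≥ 1`. -/
structure IsSemidualizing (C : ModuleCat.{u} R) : Prop where
  finite_resolution : ∃ P : LeftSeq C, ∀ n,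
    Module.Finite R (P.X n) ∧ Module.Projective R (P.X n)
  homothety : Function.Bijective (LinearMap.lsmul R C)
  ext_eq_zero : ∀ i : ℕ, 1 ≤ i → Subsingleton (Abelian.Ext.{u} C C i)

variable (C : ModuleCat.{u} R)

/-- The class `P_C` of `C`-projective modules. -/
def IsCProjective (V : ModuleCat.{u} R) : Prop :=
  ∃ P : ModuleCat.{u} R, Module.Projective R P ∧ Nonempty (V ≃ₗ[R] (C ⊗[R] P))

/-- The class `F_C` of `C`-flat modules. -/
def IsCFlat (W : ModuleCat.{u} R) : Prop :=
  ∃ F : ModuleCat.{u} R, Module.Flat R F ∧ Nonempty (W ≃ₗ[R] (C ⊗[R] F))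

/-- The class `I_C` of `C`-injective modules. -/
def IsCInjective (U : ModuleCat.{u} R) : Prop :=
  ∃ I : ModuleCat.{u} R, Module.Injective R I ∧ Nonempty (U ≃ₗ[R] (C →ₗ[R] I))

/-- The class `G(W_F)` of `W_F`-Gorenstein modules: images of `X 0 → X 1` in an exact sequence of
`C`-flat modules that is `Hom(P_C, -)` and `I_C ⊗ -` exact. -/
def IsWFGorenstein (M : ModuleCat.{u} R) : Prop :=
  ∃ S : ExactSeq R, (∀ n, IsCFlat C (S.X n)) ∧
    Nonempty (M ≃ₗ[R] LinearMap.range (S.d 0)) ∧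
    (∀ V : ModuleCat.{u} R, IsCProjective C V → S.HomExact V) ∧
    ∀ U : ModuleCat.{u} R, IsCInjective C U → S.TensorExact U

end Semidualizing

/-- `Tor_n(U, M) = 0`. -/
def TorVanishes {R : Type u} [CommRing R] (n : ℕ) (U M : ModuleCat.{u} R) : Prop :=
  Limits.IsZero (((Tor (ModuleCat.{u} R) n).obj U).obj M)

end WFGorenstein

/-! Write A⁺ for the character module Hom_ℤ(A, ℚ/ℤ). The functors Hom(C, -) and C ⊗ - identify
G(W_F) with a relative version of the Gorenstein flat modules: those N with Tor_i(A, N) = 0 for i ≥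
1, where A is injective or A = C, that embed in a flat module with cokernel of the same kind
(`IsGorFlat (TestClass C)`). The two directions are `IsWFGorenstein.isFoxbyGorFlat` and
`IsGorFlat.isWFGorenstein`. They rest on Ext^i(C, C ⊗ F) = 0 and F ≅ Hom(C, C ⊗ F) for flat F, on
Tor_i(Hom(C, I), C ⊗ F) = 0 for injective I, and on the transfer
`IsSemidualizing.extZero_tens_charMod_iff` between Tor_i(Hom(C, I), C ⊗ N) and Tor_i(I, N). Until
the comparison `torVanishes_succ_iff`, vanishing of Tor_i(A, N) is expressed as Ext^i(N, A⁺) = 0.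

GF-closedness concerns ordinary Gorenstein flat modules only. It is lifted to the relative class by
building pushouts whose quotients are flat: a module of flat dimension at most one is flat once its
Tor_1 with injectives vanishes (`SES.flat_quotient`), and `IsGorFlat.quotient_of_flat` carries the
test against C along. Through the equivalence, G(W_F) is closed under extensions, under kernels of
surjections, and under quotients whose Tor_1 with C-injectives vanishes.

What remains is the homological algebra of finite resolutions. Each condition is compared with the
existence of a G(W_F)-resolution of length n (`HasRes`). Covers by C-projectives and embeddings into
C-flats, combined with pushouts and pullbacks, move the one term that is not C-flat to any degree; a
Schanuel argument handles arbitrary syzygies; the quotient property lets vanishing of Tor shorten a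
finite resolution. For the dimension formulas the value -∞ needs a separate fact,
`IsWFGorenstein.subsingleton`. -/

namespace WFGorenstein

/-! ### Short exact sequences of modules: pushouts, pullbacks, quotients and kernels in chains. -/

section ShortExact

variable {R : Type u} [CommRing R]

/-- There is a short exact sequence `0 → A → B → D → 0`. -/
def SES (A B D : ModuleCat.{u} R) : Prop :=
  ∃ (f : A →ₗ[R] B) (g : B →ₗ[R] D), IsShortExact f g

variable {A B D A' B' D' E F K V : ModuleCat.{u} R}

theorem exists_factor_of_surjective {M N P : Type*} [AddCommGroup M] [AddCommGroup N]
    [AddCommGroup P] [Module R M] [Module R N] [Module R P] (g : M →ₗ[R] N)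
    (hg : Function.Surjective g) (t : M →ₗ[R] P) (h : ∀ x, g x = 0 → t x = 0) :
    ∃ t' : N →ₗ[R] P, ∀ x, t' (g x) = t x := by
  refine ⟨(LinearMap.ker g).liftQ t (fun x hx => h x hx) ∘ₗ
    (g.quotKerEquivOfSurjective hg).symm.toLinearMap, fun x => ?_⟩
  have : (g.quotKerEquivOfSurjective hg).symm (g x) = (LinearMap.ker g).mkQ x := by
    rw [LinearEquiv.symm_apply_eq]; rfl
  rw [LinearMap.comp_apply, LinearEquiv.coe_coe, this]
  rfl

theorem exists_lift_of_injective {M N P : Type*} [AddCommGroup M] [AddCommGroup N]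
    [AddCommGroup P] [Module R M] [Module R N] [Module R P] (f : M →ₗ[R] N)
    (hf : Function.Injective f) (t : P →ₗ[R] N) (h : ∀ x, ∃ y, f y = t x) :
    ∃ t' : P →ₗ[R] M, ∀ x, f (t' x) = t x := by
  refine ⟨(LinearEquiv.ofInjective f hf).symm.toLinearMap ∘ₗ
    t.codRestrict (LinearMap.range f) (fun x => h x), fun x => ?_⟩
  have := (LinearEquiv.ofInjective f hf).apply_symm_apply
    (t.codRestrict (LinearMap.range f) (fun x => h x) x)
  exact congrArg Subtype.val this

theorem isShortExact_ker (g : B →ₗ[R] D) (hg : Function.Surjective g) :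
    IsShortExact (A := ModuleCat.of R (LinearMap.ker g)) (LinearMap.ker g).subtype g :=
  ⟨Subtype.val_injective, LinearMap.exact_subtype_ker_map g, hg⟩

theorem isShortExact_range (f : A →ₗ[R] B) (hf : Function.Injective f) :
    IsShortExact (D := ModuleCat.of R (B ⧸ LinearMap.range f)) f (LinearMap.range f).mkQ :=
  ⟨hf, LinearMap.exact_map_mkQ_range f, Submodule.mkQ_surjective _⟩

theorem SES.congr (h : SES A B D) (eA : A ≃ₗ[R] A') (eB : B ≃ₗ[R] B') (eD : D ≃ₗ[R] D') :
    SES A' B' D' := by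
  obtain ⟨f, g, hf, hfg, hg⟩ := h
  refine ⟨eB.toLinearMap ∘ₗ f ∘ₗ eA.symm.toLinearMap, eD.toLinearMap ∘ₗ g ∘ₗ eB.symm.toLinearMap,
    ?_, ?_, ?_⟩
  · simpa using hf
  · intro y
    have := hfg (eB.symm y)
    simp only [LinearMap.comp_apply, LinearEquiv.coe_coe, LinearEquiv.map_eq_zero_iff, this]
    constructor
    · rintro ⟨x, hx⟩
      exact ⟨eA x, by simp [hx]⟩
    · rintro ⟨x, hx⟩
      exact ⟨eA.symm x, by simpa using congrArg eB.symm hx⟩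
  · simpa using hg

theorem SES.of_equiv (e : A ≃ₗ[R] B) (h : Subsingleton D) : SES A B D :=
  ⟨e.toLinearMap, 0, e.injective, fun y => by simp,
    fun y => ⟨0, Subsingleton.elim _ _⟩⟩

theorem SES.of_equiv' (h : Subsingleton A) (e : B ≃ₗ[R] D) : SES A B D :=
  ⟨0, e.toLinearMap, fun _ _ _ => Subsingleton.elim _ _, fun y => by
    simp [eq_comm (a := (0 : B))], e.surjective⟩

theorem IsShortExact.equiv_of_subsingleton_left {f : A →ₗ[R] B} {g : B →ₗ[R] D}
    (h : IsShortExact f g) [Subsingleton A] : Nonempty (B ≃ₗ[R] D) :=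
  ⟨LinearEquiv.ofBijective g ⟨(injective_iff_map_eq_zero g).2 fun y hy => by
    obtain ⟨x, rfl⟩ := (h.2.1 y).1 hy
    rw [Subsingleton.elim x 0, map_zero], h.2.2⟩⟩

/-- Pushout of two short exact sequences along the common kernel. -/
theorem SES.pushout (h : SES A B D) (h' : SES A B' D') : ∃ Z, SES B Z D' ∧ SES B' Z D := by
  obtain ⟨f, g, hf, hfg, hg⟩ := h
  obtain ⟨f', g', hf', hfg', hg'⟩ := h'
  have key (x : B) (y : B') : (LinearMap.range (f.prod (-f'))).mkQ (x, y) = 0 ↔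
      ∃ a, f a = x ∧ -f' a = y := by
    rw [Submodule.mkQ_apply, Submodule.Quotient.mk_eq_zero]
    simp
  obtain ⟨p, hp⟩ := exists_factor_of_surjective (LinearMap.range (f.prod (-f'))).mkQ
    (Submodule.mkQ_surjective _) (g' ∘ₗ LinearMap.snd R B B') (by
      rintro ⟨x, y⟩ hxy
      obtain ⟨a, -, rfl⟩ := (key x y).1 hxy
      simp [hfg'.apply_apply_eq_zero])
  obtain ⟨q, hq⟩ := exists_factor_of_surjective (LinearMap.range (f.prod (-f'))).mkQ
    (Submodule.mkQ_surjective _) (g ∘ₗ LinearMap.fst R B B') (by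
      rintro ⟨x, y⟩ hxy
      obtain ⟨a, rfl, -⟩ := (key x y).1 hxy
      simp [hfg.apply_apply_eq_zero])
  refine ⟨ModuleCat.of R ((B × B') ⧸ LinearMap.range (f.prod (-f'))),
    ⟨(LinearMap.range (f.prod (-f'))).mkQ ∘ₗ LinearMap.inl R B B', p, ?_, ?_, ?_⟩,
    ⟨(LinearMap.range (f.prod (-f'))).mkQ ∘ₗ LinearMap.inr R B B', q, ?_, ?_, ?_⟩⟩
  · refine (injective_iff_map_eq_zero _).2 fun x hx => ?_
    obtain ⟨a, rfl, ha⟩ := (key x 0).1 hx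
    rw [neg_eq_zero] at ha
    rw [(injective_iff_map_eq_zero f').1 hf' a ha, map_zero]
  · intro z
    obtain ⟨⟨x, y⟩, rfl⟩ := Submodule.mkQ_surjective _ z
    rw [hp]
    constructor
    · intro hy
      obtain ⟨a, rfl⟩ := (hfg' y).1 hy
      refine ⟨x + f a, ?_⟩
      rw [LinearMap.comp_apply, ← sub_eq_zero, ← map_sub]
      exact (key _ _).2 ⟨a, by simp, by simp⟩
    · rintro ⟨x', hx'⟩
      rw [← hp, ← hx']
      exact (hp (x', 0)).trans (by simp)
  · intro y
    obtain ⟨x, rfl⟩ := hg' y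
    exact ⟨(LinearMap.range (f.prod (-f'))).mkQ (0, x), hp _⟩
  · refine (injective_iff_map_eq_zero _).2 fun x hx => ?_
    obtain ⟨a, ha, rfl⟩ := (key 0 x).1 hx
    rw [(injective_iff_map_eq_zero f).1 hf a ha, map_zero, neg_zero]
  · intro z
    obtain ⟨⟨x, y⟩, rfl⟩ := Submodule.mkQ_surjective _ z
    rw [hq]
    constructor
    · intro hy
      obtain ⟨a, rfl⟩ := (hfg x).1 hy
      refine ⟨y + f' a, ?_⟩
      rw [LinearMap.comp_apply, ← sub_eq_zero, ← map_sub]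
      exact (key _ _).2 ⟨-a, by simp, by simp⟩
    · rintro ⟨x', hx'⟩
      rw [← hq, ← hx']
      exact (hq (0, x')).trans (by simp)
  · intro y
    obtain ⟨x, rfl⟩ := hg y
    exact ⟨(LinearMap.range (f.prod (-f'))).mkQ (x, 0), hq _⟩

/-- The last clauses record elementwise that Z is the fibre product, which is what the construction
of the second exact sequence through Z needs. -/
theorem pullback_isShortExact {f : A →ₗ[R] B} {g : B →ₗ[R] D} (h : IsShortExact f g)
    (t : B' →ₗ[R] D) : ∃ (Z : ModuleCat.{u} R) (i : A →ₗ[R] Z) (p : Z →ₗ[R] B') (q : Z →ₗ[R] B),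
      IsShortExact i p ∧ (∀ z, g (q z) = t (p z)) ∧ (∀ a, q (i a) = f a) ∧
      (∀ x y, g x = t y → ∃ z, q z = x ∧ p z = y) ∧ ∀ z, q z = 0 → p z = 0 → z = 0 := by
  obtain ⟨hf, hfg, hg⟩ := h
  let N := LinearMap.ker (g ∘ₗ LinearMap.fst R B B' - t ∘ₗ LinearMap.snd R B B')
  have hN (x : B × B') : x ∈ N ↔ g x.1 = t x.2 := by
    simp [N, sub_eq_zero]
  refine ⟨ModuleCat.of R N, (LinearMap.inl R B B' ∘ₗ f).codRestrict N (fun a => (hN _).2 (by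
    simp [hfg.apply_apply_eq_zero])), LinearMap.snd R B B' ∘ₗ N.subtype,
    LinearMap.fst R B B' ∘ₗ N.subtype, ⟨?_, ?_, ?_⟩, ?_, ?_, ?_, ?_⟩
  · intro a b hab
    exact hf (congrArg (fun z : N => z.1.1) hab)
  · rintro ⟨⟨x, y⟩, hxy⟩
    have hxy' := (hN _).1 hxy
    dsimp only at hxy'
    constructor
    · intro hy
      change y = 0 at hy
      subst hy
      obtain ⟨a, rfl⟩ := (hfg x).1 (by simpa using hxy')
      exact ⟨a, rfl⟩
    · rintro ⟨a, ha⟩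
      exact (congrArg (fun z : N => z.1.2) ha).symm
  · intro y
    obtain ⟨x, hx⟩ := hg (t y)
    exact ⟨⟨(x, y), (hN _).2 hx⟩, rfl⟩
  · exact fun z => (hN _).1 z.2
  · exact fun a => rfl
  · exact fun x y hxy => ⟨⟨(x, y), (hN _).2 hxy⟩, rfl, rfl⟩
  · exact fun z hz hz' => Subtype.ext (Prod.ext hz hz')

/-- Pullback of two short exact sequences along the common cokernel. -/
theorem SES.pullback (h : SES A B D) (h' : SES A' B' D) : ∃ Z, SES A Z B' ∧ SES A' Z B := by
  obtain ⟨f, g, h⟩ := h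
  obtain ⟨f', g', hf', hfg', hg'⟩ := h'
  obtain ⟨Z, i, p, q, hip, hz, -, hex, h0⟩ := pullback_isShortExact h g'
  have hj (a : A') : ∃ z, q z = 0 ∧ p z = f' a :=
    hex 0 (f' a) (by simp [hfg'.apply_apply_eq_zero])
  choose j hj₁ hj₂ using hj
  have huniq (z w : Z) (h₁ : q z = q w) (h₂ : p z = p w) : z = w :=
    sub_eq_zero.1 (h0 _ (by simp [h₁]) (by simp [h₂]))
  refine ⟨Z, ⟨i, p, hip⟩, ⟨⟨⟨j, fun a b => huniq _ _ (by simp [hj₁]) (by simp [hj₂])⟩,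
    fun r a => huniq _ _ (by simp [hj₁]) (by simp [hj₂])⟩, q, ?_, ?_, ?_⟩⟩
  · intro a b hab
    apply hf'
    rw [← hj₂, ← hj₂]
    exact congrArg p hab
  · intro z
    constructor
    · intro hq
      obtain ⟨a, ha⟩ := (hfg' (p z)).1 (by rw [← hz, hq, map_zero])
      exact ⟨a, huniq _ _ ((hj₁ a).trans hq.symm) ((hj₂ a).trans ha)⟩
    · rintro ⟨a, rfl⟩
      exact hj₁ a
  · intro x
    obtain ⟨y, hy⟩ := hg' (g x)
    obtain ⟨z, hz, -⟩ := hex x y hy.symm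
    exact ⟨z, hz⟩

/-- The quotients in a chain `A ⊆ B ⊆ F`. -/
theorem SES.quotient (h : SES A B D) (h' : SES B F E) : ∃ Q, SES A F Q ∧ SES D Q E := by
  obtain ⟨f, g, hf, hfg, hg⟩ := h
  obtain ⟨f', g', hf', hfg', hg'⟩ := h'
  obtain ⟨s, hs⟩ := exists_factor_of_surjective g hg ((LinearMap.range (f' ∘ₗ f)).mkQ ∘ₗ f') (by
    intro x hx
    obtain ⟨a, rfl⟩ := (hfg x).1 hx
    simp)
  obtain ⟨t, ht⟩ := exists_factor_of_surjective (LinearMap.range (f' ∘ₗ f)).mkQ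
    (Submodule.mkQ_surjective _) g' (by
      intro x hx
      rw [Submodule.mkQ_apply, Submodule.Quotient.mk_eq_zero] at hx
      obtain ⟨a, rfl⟩ := hx
      exact hfg'.apply_apply_eq_zero _)
  refine ⟨ModuleCat.of R (F ⧸ LinearMap.range (f' ∘ₗ f)), ⟨f' ∘ₗ f, _,
    isShortExact_range _ (hf'.comp hf)⟩, ⟨s, t, ?_, ?_, ?_⟩⟩
  · refine (injective_iff_map_eq_zero _).2 fun y hy => ?_
    obtain ⟨x, rfl⟩ := hg y
    rw [hs, LinearMap.comp_apply, Submodule.mkQ_apply, Submodule.Quotient.mk_eq_zero] at hy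
    obtain ⟨a, ha⟩ := hy
    rw [← hf' ha]
    exact hfg.apply_apply_eq_zero a
  · intro z
    obtain ⟨x, rfl⟩ := Submodule.mkQ_surjective _ z
    rw [ht]
    constructor
    · intro hx
      obtain ⟨b, rfl⟩ := (hfg' x).1 hx
      exact ⟨g b, hs b⟩
    · rintro ⟨y, hy⟩
      obtain ⟨b, rfl⟩ := hg y
      rw [← ht, ← hy, hs, LinearMap.comp_apply, ht]
      exact hfg'.apply_apply_eq_zero b
  · intro e
    obtain ⟨x, rfl⟩ := hg' e
    exact ⟨_, ht x⟩

/-- The kernels in a chain of quotients `V ↠ B ↠ D`. -/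
theorem SES.kernel (h : SES K V B) (h' : SES A B D) : ∃ Z, SES Z V D ∧ SES K Z A := by
  obtain ⟨k, v, hk, hkv, hv⟩ := h
  obtain ⟨f, g, hf, hfg, hg⟩ := h'
  obtain ⟨s, hs⟩ := exists_lift_of_injective (LinearMap.ker (g ∘ₗ v)).subtype
    Subtype.val_injective k (fun x => ⟨⟨k x, by simp [hkv.apply_apply_eq_zero]⟩, rfl⟩)
  obtain ⟨t, ht⟩ := exists_lift_of_injective f hf (v ∘ₗ (LinearMap.ker (g ∘ₗ v)).subtype)
    (fun x => (hfg _).1 x.2)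
  refine ⟨ModuleCat.of R (LinearMap.ker (g ∘ₗ v)), ⟨_, g ∘ₗ v,
    isShortExact_ker _ (hg.comp hv)⟩, ⟨s, t, ?_, ?_, ?_⟩⟩
  · intro x y hxy
    apply hk
    rw [← hs, ← hs, hxy]
  · intro z
    rw [← (injective_iff_map_eq_zero' f).1 hf, ht]
    constructor
    · intro hz
      obtain ⟨x, hx⟩ := (hkv _).1 hz
      exact ⟨x, Subtype.ext ((hs x).trans hx)⟩
    · rintro ⟨x, rfl⟩
      rw [LinearMap.comp_apply, hs]
      exact hkv.apply_apply_eq_zero x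
  · intro a
    obtain ⟨x, hx⟩ := hv (f a)
    exact ⟨⟨x, by simp [hx, hfg.apply_apply_eq_zero]⟩, hf (by rw [ht]; exact hx)⟩

end ShortExact

/-! ### Vanishing of Ext along short exact sequences. -/

section Ext

variable {R : Type u} [CommRing R]

/-- `Ext^i(X, Y) = 0`. -/
def ExtZero (X Y : ModuleCat.{u} R) (i : ℕ) : Prop := Subsingleton (Abelian.Ext.{u} X Y i)

variable {A B D X Y : ModuleCat.{u} R}

theorem IsShortExact.shortExact {f : A →ₗ[R] B} {g : B →ₗ[R] D} (h : IsShortExact f g) :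
    (ShortComplex.moduleCatMk f g h.2.1.linearMap_comp_eq_zero).ShortExact where
  exact := (ShortComplex.ShortExact.moduleCat_exact_iff_function_exact _).2 h.2.1
  mono_f := (ModuleCat.mono_iff_injective _).2 h.1
  epi_g := (ModuleCat.epi_iff_surjective _).2 h.2.2

theorem ExtZero.of_projective (X Y : ModuleCat.{u} R) [Module.Projective R X] (i : ℕ) :
    ExtZero X Y (i + 1) :=
  have : Projective X := (IsProjective.iff_projective X).1 inferInstance
  Abelian.Ext.subsingleton_of_projective X Y i

theorem ExtZero.of_injective (X Y : ModuleCat.{u} R) [Module.Injective R Y] (i : ℕ) :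
    ExtZero X Y (i + 1) :=
  have : Injective Y := Module.injective_object_of_injective_module R Y
  Abelian.Ext.subsingleton_of_injective X Y i

theorem ExtZero.congr_left (e : A ≃ₗ[R] B) {i : ℕ} (h : ExtZero A Y i) : ExtZero B Y i := by
  have : Subsingleton _ := h
  refine ⟨fun x y => ?_⟩
  have key (z : Abelian.Ext.{u} B Y i) : z = (Abelian.Ext.mk₀ e.toModuleIso.inv).comp
      ((Abelian.Ext.mk₀ e.toModuleIso.hom).comp z (zero_add i)) (zero_add i) := by
    rw [Abelian.Ext.mk₀_comp_mk₀_assoc, Iso.inv_hom_id, Abelian.Ext.mk₀_id_comp]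
  rw [key x, key y, Subsingleton.elim ((Abelian.Ext.mk₀ e.toModuleIso.hom).comp x (zero_add i))
    ((Abelian.Ext.mk₀ e.toModuleIso.hom).comp y (zero_add i))]

theorem ExtZero.congr_right (e : A ≃ₗ[R] B) {i : ℕ} (h : ExtZero X A i) : ExtZero X B i := by
  have : Subsingleton _ := h
  refine ⟨fun x y => ?_⟩
  have key (z : Abelian.Ext.{u} X B i) : z = (z.comp (Abelian.Ext.mk₀ e.toModuleIso.inv)
      (add_zero i)).comp (Abelian.Ext.mk₀ e.toModuleIso.hom) (add_zero i) := by
    rw [Abelian.Ext.comp_assoc_of_second_deg_zero, Abelian.Ext.mk₀_comp_mk₀, Iso.inv_hom_id,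
      Abelian.Ext.comp_mk₀_id]
  rw [key x, key y, Subsingleton.elim (x.comp (Abelian.Ext.mk₀ e.toModuleIso.inv) (add_zero i))
    (y.comp (Abelian.Ext.mk₀ e.toModuleIso.inv) (add_zero i))]

section

variable {S : ShortComplex (ModuleCat.{u} R)} (hS : S.ShortExact)

include hS

theorem extZero_X₂_left {i : ℕ} (hA : ExtZero S.X₁ Y i) (hD : ExtZero S.X₃ Y i) :
    ExtZero S.X₂ Y i := by
  refine @subsingleton_of_forall_eq _ 0 fun x => ?_
  obtain ⟨y, rfl⟩ := Abelian.Ext.contravariant_sequence_exact₂ hS Y x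
    (@Subsingleton.elim _ hA _ _)
  rw [@Subsingleton.elim _ hD y 0, Abelian.Ext.comp_zero]

theorem extZero_X₁_left {i : ℕ} (hB : ExtZero S.X₂ Y i) (hD : ExtZero S.X₃ Y (i + 1)) :
    ExtZero S.X₁ Y i := by
  refine @subsingleton_of_forall_eq _ 0 fun x => ?_
  obtain ⟨y, rfl⟩ := Abelian.Ext.contravariant_sequence_exact₁ hS Y x (add_comm 1 i)
    (@Subsingleton.elim _ hD _ _)
  rw [@Subsingleton.elim _ hB y 0, Abelian.Ext.comp_zero]

theorem extZero_X₃_left {i : ℕ} (hA : ExtZero S.X₁ Y i) (hB : ExtZero S.X₂ Y (i + 1)) :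
    ExtZero S.X₃ Y (i + 1) := by
  refine @subsingleton_of_forall_eq _ 0 fun x => ?_
  obtain ⟨y, rfl⟩ := Abelian.Ext.contravariant_sequence_exact₃ hS Y x
    (@Subsingleton.elim _ hB _ _) (add_comm 1 i)
  rw [@Subsingleton.elim _ hA y 0, Abelian.Ext.comp_zero]

theorem extZero_X₃_right {i : ℕ} (hB : ExtZero X S.X₂ i) (hA : ExtZero X S.X₁ (i + 1)) :
    ExtZero X S.X₃ i := by
  refine @subsingleton_of_forall_eq _ 0 fun x => ?_
  obtain ⟨y, rfl⟩ := Abelian.Ext.covariant_sequence_exact₃ X hS x rfl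
    (@Subsingleton.elim _ hA _ _)
  rw [@Subsingleton.elim _ hB y 0, Abelian.Ext.zero_comp]

theorem extZero_X₁_right {i : ℕ} (hD : ExtZero X S.X₃ i) (hB : ExtZero X S.X₂ (i + 1)) :
    ExtZero X S.X₁ (i + 1) := by
  refine @subsingleton_of_forall_eq _ 0 fun x => ?_
  obtain ⟨y, rfl⟩ := Abelian.Ext.covariant_sequence_exact₁ X hS x
    (@Subsingleton.elim _ hB _ _) rfl
  rw [@Subsingleton.elim _ hD y 0, Abelian.Ext.zero_comp]

theorem exists_extend_of_extZero (hD : ExtZero S.X₃ Y 1) (φ : S.X₁ ⟶ Y) :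
    ∃ ψ : S.X₂ ⟶ Y, S.f ≫ ψ = φ := by
  obtain ⟨y, hy⟩ := Abelian.Ext.contravariant_sequence_exact₁ hS Y
    (Abelian.Ext.mk₀ φ) (add_comm 1 0) (@Subsingleton.elim _ hD _ _)
  obtain ⟨ψ, rfl⟩ := (Abelian.Ext.mk₀_bijective _ _).2 y
  rw [Abelian.Ext.mk₀_comp_mk₀] at hy
  exact ⟨ψ, (Abelian.Ext.mk₀_bijective _ _).1 hy⟩

theorem exists_lift_of_extZero (hA : ExtZero X S.X₁ 1) (φ : X ⟶ S.X₃) :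
    ∃ ψ : X ⟶ S.X₂, ψ ≫ S.g = φ := by
  obtain ⟨y, hy⟩ := Abelian.Ext.covariant_sequence_exact₃ X hS
    (Abelian.Ext.mk₀ φ) rfl (@Subsingleton.elim _ hA _ _)
  obtain ⟨ψ, rfl⟩ := (Abelian.Ext.mk₀_bijective _ _).2 y
  rw [Abelian.Ext.mk₀_comp_mk₀] at hy
  exact ⟨ψ, (Abelian.Ext.mk₀_bijective _ _).1 hy⟩

/-- Since Ext¹ of the middle term vanishes, every class in Ext¹(X₃, Y) is the connecting image of a
map X₁ → Y, and this image is zero when the map extends to X₂. -/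
theorem extZero_one_X₃ (hB : ExtZero S.X₂ Y 1)
    (hex : ∀ φ : S.X₁ ⟶ Y, ∃ ψ : S.X₂ ⟶ Y, S.f ≫ ψ = φ) : ExtZero S.X₃ Y 1 := by
  refine @subsingleton_of_forall_eq _ 0 fun x => ?_
  obtain ⟨y, rfl⟩ := Abelian.Ext.contravariant_sequence_exact₃ hS Y x
    (@Subsingleton.elim _ hB _ _) (add_comm 1 0)
  obtain ⟨φ, rfl⟩ := (Abelian.Ext.mk₀_bijective _ _).2 y
  obtain ⟨ψ, rfl⟩ := hex φ
  rw [← Abelian.Ext.mk₀_comp_mk₀]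
  exact hS.extClass_comp_assoc _

theorem extZero_one_X₁ (hB : ExtZero X S.X₂ 1)
    (hex : ∀ φ : X ⟶ S.X₃, ∃ ψ : X ⟶ S.X₂, ψ ≫ S.g = φ) : ExtZero X S.X₁ 1 := by
  refine @subsingleton_of_forall_eq _ 0 fun x => ?_
  obtain ⟨y, rfl⟩ := Abelian.Ext.covariant_sequence_exact₁ X hS x
    (@Subsingleton.elim _ hB _ _) rfl
  obtain ⟨φ, rfl⟩ := (Abelian.Ext.mk₀_bijective _ _).2 y
  obtain ⟨ψ, rfl⟩ := hex φ
  rw [← Abelian.Ext.mk₀_comp_mk₀, Abelian.Ext.comp_assoc_of_second_deg_zero, hS.comp_extClass,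
    Abelian.Ext.comp_zero]

end

section

variable {f : A →ₗ[R] B} {g : B →ₗ[R] D} (h : IsShortExact f g)

include h

theorem IsShortExact.extZero_mid_left {i : ℕ} (hA : ExtZero A Y i) (hD : ExtZero D Y i) :
    ExtZero B Y i :=
  extZero_X₂_left h.shortExact hA hD

theorem IsShortExact.extZero_sub_left {i : ℕ} (hB : ExtZero B Y i) (hD : ExtZero D Y (i + 1)) :
    ExtZero A Y i :=
  extZero_X₁_left h.shortExact hB hD

theorem IsShortExact.extZero_quot_left {i : ℕ} (hA : ExtZero A Y i) (hB : ExtZero B Y (i + 1)) :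
    ExtZero D Y (i + 1) :=
  extZero_X₃_left h.shortExact hA hB

theorem IsShortExact.extZero_quot_right {i : ℕ} (hB : ExtZero X B i) (hA : ExtZero X A (i + 1)) :
    ExtZero X D i :=
  extZero_X₃_right h.shortExact hB hA

theorem IsShortExact.extZero_sub_right {i : ℕ} (hD : ExtZero X D i) (hB : ExtZero X B (i + 1)) :
    ExtZero X A (i + 1) :=
  extZero_X₁_right h.shortExact hD hB

theorem IsShortExact.exists_extend (hD : ExtZero D Y 1) (φ : A →ₗ[R] Y) :
    ∃ ψ : B →ₗ[R] Y, ψ ∘ₗ f = φ := by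
  obtain ⟨ψ, hψ⟩ := exists_extend_of_extZero h.shortExact hD (ModuleCat.ofHom φ)
  exact ⟨ψ.hom, ModuleCat.hom_ext_iff.1 hψ⟩

theorem IsShortExact.exists_lift (hA : ExtZero X A 1) (φ : X →ₗ[R] D) :
    ∃ ψ : X →ₗ[R] B, g ∘ₗ ψ = φ := by
  obtain ⟨ψ, hψ⟩ := exists_lift_of_extZero h.shortExact hA (ModuleCat.ofHom φ)
  exact ⟨ψ.hom, ModuleCat.hom_ext_iff.1 hψ⟩

theorem IsShortExact.extZero_one_of_extend (hB : ExtZero B Y 1)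
    (hex : ∀ φ : A →ₗ[R] Y, ∃ ψ : B →ₗ[R] Y, ψ ∘ₗ f = φ) : ExtZero D Y 1 := by
  refine extZero_one_X₃ h.shortExact hB fun φ => ?_
  obtain ⟨ψ, hψ⟩ := hex φ.hom
  exact ⟨ModuleCat.ofHom ψ, ModuleCat.hom_ext hψ⟩

theorem IsShortExact.extZero_one_of_lift (hB : ExtZero X B 1)
    (hex : ∀ φ : X →ₗ[R] D, ∃ ψ : X →ₗ[R] B, g ∘ₗ ψ = φ) : ExtZero X A 1 := by
  refine extZero_one_X₁ h.shortExact hB fun φ => ?_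
  obtain ⟨ψ, hψ⟩ := hex φ.hom
  exact ⟨ModuleCat.ofHom ψ, ModuleCat.hom_ext hψ⟩

end

/-- A free cover. -/
theorem exists_free_cover (N : ModuleCat.{u} R) :
    ∃ K P : ModuleCat.{u} R, Module.Free R P ∧ SES K P N := by
  refine ⟨_, ModuleCat.of R (N →₀ R), inferInstanceAs (Module.Free R (N →₀ R)), _, _,
    isShortExact_ker (Finsupp.linearCombination R (id : N → N))
      (Finsupp.linearCombination_id_surjective R N)⟩

/-! ### Character modules -/

/-- The character module, as an object of the category of modules. -/
abbrev charMod (A : ModuleCat.{u} R) : ModuleCat.{u} R := ModuleCat.of R (CharacterModule A)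

theorem IsShortExact.dual {f : A →ₗ[R] B} {g : B →ₗ[R] D} (h : IsShortExact f g) :
    IsShortExact (A := charMod D) (B := charMod B) (D := charMod A)
      (CharacterModule.dual g) (CharacterModule.dual f) := by
  refine ⟨CharacterModule.dual_injective_of_surjective g h.2.2, fun φ => ?_,
    CharacterModule.dual_surjective_of_injective f h.1⟩
  constructor
  · intro hφ
    obtain ⟨t, ht⟩ := exists_factor_of_surjective (R := ℤ) g.toAddMonoidHom.toIntLinearMap h.2.2
      (AddMonoidHom.toIntLinearMap φ) (fun x hx => by
        obtain ⟨a, rfl⟩ := (h.2.1 x).1 hx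
        exact DFunLike.congr_fun hφ a)
    exact ⟨t.toAddMonoidHom, DFunLike.ext _ _ ht⟩
  · rintro ⟨ψ, rfl⟩
    refine DFunLike.ext _ _ fun a => ?_
    change ψ (g (f a)) = 0
    rw [h.2.1.apply_apply_eq_zero, map_zero]

/-- Swapping the arguments of a pairing with values in `ℚ / ℤ`. -/
def charFlip {M N : Type*} [AddCommGroup M] [AddCommGroup N] [Module R M] [Module R N]
    (φ : M →ₗ[R] CharacterModule N) : N →ₗ[R] CharacterModule M where
  toFun n :=
    { toFun := fun m => φ m n
      map_zero' := by rw [map_zero]; rfl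
      map_add' := fun x y => by rw [map_add]; rfl }
  map_add' x y := DFunLike.ext _ _ fun m => map_add (φ m) x y
  map_smul' r x := DFunLike.ext _ _ fun m => by
    change φ m (r • x) = φ (r • m) x
    rw [LinearMap.map_smul φ]; rfl

theorem injective_charMod (F : ModuleCat.{u} R) [Module.Flat R F] :
    Module.Injective R (charMod F) :=
  Module.Flat.iff_characterModule_injective.1 inferInstance

/-- `Tor_i(A, F) = 0` for flat `F`, in terms of `Ext`. -/
theorem ExtZero.of_flat (F A : ModuleCat.{u} R) [Module.Flat R F] (i : ℕ) :
    ExtZero F (charMod A) (i + 1) := by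
  induction i generalizing A with
  | zero =>
    obtain ⟨L, Q, _, f, g, h⟩ := exists_free_cover A
    have := injective_charMod Q
    refine h.dual.extZero_one_of_lift (.of_injective _ _ 0) fun φ => ?_
    -- Flatness enters here: injectivity of f ⊗ F is, by duality, extendability of maps into F⁺
    -- along f, and flipping the pairing gives the lifting along A⁺-side duals.
    have hinj : Function.Injective (f.rTensor F) := Module.Flat.rTensor_preserves_injective_linearMap f h.1
    obtain ⟨ψ, hψ⟩ := rTensor_injective_iff_lcomp_surjective.1 hinj (charFlip φ)
    exact ⟨charFlip ψ, LinearMap.ext fun x => DFunLike.ext _ _ fun y =>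
      DFunLike.congr_fun (LinearMap.congr_fun hψ y) x⟩
  | succ i ih =>
    obtain ⟨L, Q, _, f, g, h⟩ := exists_free_cover A
    have := injective_charMod Q
    exact h.dual.extZero_sub_right (ih L) (.of_injective _ _ _)

end Ext

/-! ### Gorenstein flat modules relative to a class of test modules, and their closure properties.
-/

section RelativeGorensteinFlat

variable {R : Type u} [CommRing R]

/-- `Tor_i(A, N) = 0` for all `i ≥ 1` and all `A` in the class `𝒜`, expressed through character
modules. -/
def TorZero (𝒜 : ModuleCat.{u} R → Prop) (N : ModuleCat.{u} R) : Prop :=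
  ∀ A, 𝒜 A → ∀ i : ℕ, ExtZero N (charMod A) (i + 1)

/-- Gorenstein flat modules relative to a class `𝒜` of test modules, as the largest class of
`Tor`-acyclic modules whose members embed into a flat module with cokernel in the class. -/
def IsGorFlat (𝒜 : ModuleCat.{u} R → Prop) (N : ModuleCat.{u} R) : Prop :=
  ∃ 𝒦 : ModuleCat.{u} R → Prop, 𝒦 N ∧ ∀ X, 𝒦 X → TorZero 𝒜 X ∧
    ∃ F Y : ModuleCat.{u} R, Module.Flat R F ∧ 𝒦 Y ∧ SES X F Y

variable {𝒜 ℬ : ModuleCat.{u} R → Prop} {A B D E F K N N' Q Z : ModuleCat.{u} R}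

theorem TorZero.mono (hℬ : ∀ X, ℬ X → 𝒜 X) (h : TorZero 𝒜 N) : TorZero ℬ N :=
  fun A hA => h A (hℬ A hA)

theorem TorZero.congr (e : N ≃ₗ[R] N') (h : TorZero 𝒜 N) : TorZero 𝒜 N' :=
  fun A hA i => (h A hA i).congr_left e

theorem TorZero.of_flat (F : ModuleCat.{u} R) [Module.Flat R F] : TorZero 𝒜 F :=
  fun A _ i => .of_flat F A i

theorem SES.torZero_mid (h : SES A B D) (hA : TorZero 𝒜 A) (hD : TorZero 𝒜 D) : TorZero 𝒜 B := by
  obtain ⟨f, g, h⟩ := h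
  exact fun X hX i => h.extZero_mid_left (hA X hX i) (hD X hX i)

theorem SES.torZero_sub (h : SES A B D) (hB : TorZero 𝒜 B) (hD : TorZero 𝒜 D) : TorZero 𝒜 A := by
  obtain ⟨f, g, h⟩ := h
  exact fun X hX i => h.extZero_sub_left (hB X hX i) (hD X hX (i + 1))

theorem IsGorFlat.torZero (h : IsGorFlat 𝒜 N) : TorZero 𝒜 N := by
  obtain ⟨𝒦, hN, h𝒦⟩ := h
  exact (h𝒦 N hN).1

theorem IsGorFlat.exists_coresolution (h : IsGorFlat 𝒜 N) :
    ∃ F N' : ModuleCat.{u} R, Module.Flat R F ∧ IsGorFlat 𝒜 N' ∧ SES N F N' := by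
  obtain ⟨𝒦, hN, h𝒦⟩ := h
  obtain ⟨-, F, Y, hF, hY, hs⟩ := h𝒦 N hN
  exact ⟨F, Y, hF, ⟨𝒦, hY, h𝒦⟩, hs⟩

theorem IsGorFlat.mono (hℬ : ∀ X, ℬ X → 𝒜 X) (h : IsGorFlat 𝒜 N) : IsGorFlat ℬ N := by
  obtain ⟨𝒦, hN, h𝒦⟩ := h
  exact ⟨𝒦, hN, fun X hX => ⟨(h𝒦 X hX).1.mono hℬ, (h𝒦 X hX).2⟩⟩

/-- Coinduction up to members of the class of relative Gorenstein flat modules. -/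
theorem IsGorFlat.coinduct (𝒦 : ModuleCat.{u} R → Prop) (h𝒦 : ∀ X, 𝒦 X → TorZero 𝒜 X ∧
    ∃ F Y : ModuleCat.{u} R, Module.Flat R F ∧ (𝒦 Y ∨ IsGorFlat 𝒜 Y) ∧ SES X F Y)
    (hN : 𝒦 N) : IsGorFlat 𝒜 N := by
  refine ⟨fun X => 𝒦 X ∨ IsGorFlat 𝒜 X, Or.inl hN, fun X hX => ?_⟩
  rcases hX with hX | hX
  · exact h𝒦 X hX
  · obtain ⟨F, Y, hF, hY, hs⟩ := hX.exists_coresolution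
    exact ⟨hX.torZero, F, Y, hF, Or.inr hY, hs⟩

theorem IsGorFlat.of_ses (hN : TorZero 𝒜 N) [Module.Flat R F] (hN' : IsGorFlat 𝒜 N')
    (h : SES N F N') : IsGorFlat 𝒜 N :=
  IsGorFlat.coinduct (· = N) (by
    rintro _ rfl
    exact ⟨hN, F, N', inferInstance, Or.inr hN', h⟩) rfl

/-- Kernels of surjections from a flat module onto a relative Gorenstein flat module. -/
theorem IsGorFlat.syzygy [Module.Flat R F] (hN : IsGorFlat 𝒜 N) (h : SES K F N) :
    IsGorFlat 𝒜 K :=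
  .of_ses (h.torZero_sub (.of_flat F) hN.torZero) hN h

theorem IsGorFlat.congr (e : N ≃ₗ[R] N') (h : IsGorFlat 𝒜 N) : IsGorFlat 𝒜 N' := by
  obtain ⟨F, Y, hF, hY, hs⟩ := h.exists_coresolution
  exact .of_ses (h.torZero.congr e) hY (hs.congr e (.refl R F) (.refl R Y))

theorem IsGorFlat.of_flat (F : ModuleCat.{u} R) [Module.Flat R F] : IsGorFlat 𝒜 F :=
  IsGorFlat.coinduct (fun X => Module.Flat R X) (fun X _ => ⟨.of_flat X, X, ModuleCat.of R PUnit,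
    inferInstance, Or.inl inferInstance, .of_equiv (.refl R X) inferInstance⟩) inferInstance

/-- The class of injective modules. -/
def InjClass (R : Type u) [CommRing R] (I : ModuleCat.{u} R) : Prop := Module.Injective R I

theorem exists_injective_hull (A : ModuleCat.{u} R) :
    ∃ I B : ModuleCat.{u} R, Module.Injective R I ∧ SES A I B := by
  refine ⟨Injective.under A, _,
    (Module.injective_iff_injective_object R _).2 (inferInstanceAs (Injective (Injective.under A))),
    (Injective.ι A).hom, _,
    isShortExact_range _ ((ModuleCat.mono_iff_injective _).1 inferInstance)⟩

/-- A module is flat if `Tor_1(A, -)` vanishes on it for all `A`. -/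
theorem flat_of_extZero (h : ∀ A, ExtZero N (charMod A) 1) : Module.Flat R N := by
  rw [Module.Flat.iff_rTensor_injective']
  intro I
  rw [rTensor_injective_iff_lcomp_surjective]
  intro φ
  obtain ⟨ψ, hψ⟩ := (isShortExact_range (A := ModuleCat.of R I) (B := ModuleCat.of R R) I.subtype
    Subtype.val_injective).dual.exists_lift (h _) (charFlip φ)
  exact ⟨charFlip ψ, LinearMap.ext fun x => DFunLike.ext _ _ fun y =>
      DFunLike.congr_fun (LinearMap.congr_fun hψ y) x⟩

/-- A module of flat dimension at most one is flat if `Tor_1` with injective modules vanishes. -/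
theorem SES.flat_quotient [Module.Flat R A] [Module.Flat R B] (h : SES A B D)
    (hD : ∀ I : ModuleCat.{u} R, Module.Injective R I → ExtZero D (charMod I) 1) : Module.Flat R D := by
  obtain ⟨f, g, h⟩ := h
  refine flat_of_extZero fun X => ?_
  -- Tor_2(Y, D) = 0 because D has flat dimension at most one, so Tor_1(X, D) is controlled by
  -- Tor_1(I, D) = 0.
  obtain ⟨I, Y, hI, i, p, hs⟩ := exists_injective_hull X
  exact hs.dual.extZero_quot_right (hD I hI)
    (h.extZero_quot_left (.of_flat A Y 0) (.of_flat B Y 1))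

/-- In degrees at least two this is a dimension shift to N. In degree one, a map N → A⁺ extends to
the flat F ⊇ N; a map F → A⁺ factors through F → F⁺⁺, and N → F⁺⁺ extends to Q because F⁺ is
injective and Z is acyclic against injectives. -/
theorem IsGorFlat.torZero_quotient [Module.Flat R Q] (hN : IsGorFlat 𝒜 N)
    (hZ : TorZero (InjClass R) Z) (h : SES N Q Z) : TorZero 𝒜 Z := by
  obtain ⟨j, p, h⟩ := h
  obtain ⟨F, Y, hF, hY, k, q, hs⟩ := hN.exists_coresolution
  intro A hA i
  cases i with
  | succ i => exact h.extZero_quot_left (hN.torZero A hA i) (.of_flat Q A _)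
  | zero =>
    refine h.extZero_one_of_extend (.of_flat Q A 0) fun φ => ?_
    obtain ⟨ψ, rfl⟩ := hs.exists_extend (hY.torZero A hA 0) φ
    obtain ⟨χ, hχ⟩ := h.exists_extend (hZ (charMod F) (injective_charMod F) 0)
      (charFlip (LinearMap.id : CharacterModule F →ₗ[R] CharacterModule F) ∘ₗ k)
    -- The dual of the flipped map A → F⁺ is the factorization F⁺⁺ → A⁺ of ψ.
    refine ⟨CharacterModule.dual (charFlip ψ) ∘ₗ χ, ?_⟩
    rw [LinearMap.comp_assoc, hχ]
    rfl

section ExtensionClosed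

variable (h𝒜 : ∀ I : ModuleCat.{u} R, Module.Injective R I → 𝒜 I)
  (hext : ∀ {A B D : ModuleCat.{u} R}, SES A B D → IsGorFlat (InjClass R) A →
    IsGorFlat (InjClass R) D → IsGorFlat (InjClass R) B)

include h𝒜 hext

/-- Coinduction on the modules Z that are Gorenstein flat and are also the cokernel of a relative
Gorenstein flat N in a flat Q. Ordinary extension closure suffices to produce the next step. -/
theorem IsGorFlat.quotient_of_flat [Module.Flat R Q] (hN : IsGorFlat 𝒜 N)
    (hZ : IsGorFlat (InjClass R) Z) (h : SES N Q Z) : IsGorFlat 𝒜 Z := by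
  refine IsGorFlat.coinduct (fun Z => IsGorFlat (InjClass R) Z ∧ ∃ N Q : ModuleCat.{u} R,
    IsGorFlat 𝒜 N ∧ Module.Flat R Q ∧ SES N Q Z) ?_ ⟨hZ, N, Q, hN, inferInstance, h⟩
  clear hN hZ h
  rintro Z ⟨hZ, N, Q, hN, hQ, h⟩
  obtain ⟨F, N', hF, hN', hs⟩ := hN.exists_coresolution
  -- Y is both an extension of N' by Q and one of Z by F. Embedding it in a flat F' gives Z ↪ F'/F
  -- with cokernel Y', while N' ↪ F'/Q also has cokernel Y'; so Y' has the same form as Z.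
  obtain ⟨Y, hQY, hFY⟩ := h.pushout hs
  have hY : IsGorFlat (InjClass R) Y := hext hQY (.of_flat Q) (hN'.mono h𝒜)
  obtain ⟨F', Y', hF', hY', hYY'⟩ := hY.exists_coresolution
  obtain ⟨Q₁, h₁, h₁'⟩ := hQY.quotient hYY'
  obtain ⟨Q₂, h₂, h₂'⟩ := hFY.quotient hYY'
  have hQ₁ : Module.Flat R Q₁ := h₁.flat_quotient fun I hI =>
    h₁'.torZero_mid (hN'.mono h𝒜).torZero hY'.torZero I hI 0
  have hQ₂ : Module.Flat R Q₂ := h₂.flat_quotient fun I hI =>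
    h₂'.torZero_mid hZ.torZero hY'.torZero I hI 0
  exact ⟨hN.torZero_quotient hZ.torZero h, Q₂, Y', hQ₂, Or.inl ⟨hY', N', Q₁, hN', hQ₁, h₁'⟩, h₂'⟩

/-- Embed Z in a flat F. Then F/Q is flat and contains N with cokernel F/Z, so F/Z is relative
Gorenstein flat and Z is its syzygy. -/
theorem IsGorFlat.extension_of_flat [Module.Flat R Q] (hN : IsGorFlat 𝒜 N)
    (h : SES Q Z N) : IsGorFlat 𝒜 Z := by
  have hZ : IsGorFlat (InjClass R) Z := hext h (.of_flat Q) (hN.mono h𝒜)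
  obtain ⟨F, Z', hF, hZ', hs⟩ := hZ.exists_coresolution
  obtain ⟨Q', h₁, h₂⟩ := h.quotient hs
  have hQ' : Module.Flat R Q' := h₁.flat_quotient fun I hI =>
    h₂.torZero_mid (hN.mono h𝒜).torZero hZ'.torZero I hI 0
  exact (hN.quotient_of_flat h𝒜 hext hZ' h₂).syzygy hs

/-- Relative Gorenstein flat modules are closed under extensions. -/
theorem IsGorFlat.extension (h : SES A B D) (hA : IsGorFlat 𝒜 A) (hD : IsGorFlat 𝒜 D) :
    IsGorFlat 𝒜 B := by
  refine IsGorFlat.coinduct (fun B => ∃ A D : ModuleCat.{u} R, IsGorFlat 𝒜 A ∧ IsGorFlat 𝒜 D ∧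
    SES A B D) ?_ ⟨A, D, hA, hD, h⟩
  clear h hA hD
  rintro B ⟨A, D, hA, hD, h⟩
  obtain ⟨F, A', hF, hA', hs⟩ := hA.exists_coresolution
  -- P extends D by the flat F, so it embeds in a flat F' with good cokernel P'; then F'/B is an
  -- extension of P' by A', which closes the coinduction.
  obtain ⟨P, h₁, h₂⟩ := h.pushout hs
  obtain ⟨F', P', hF', hP', h₃⟩ := (hD.extension_of_flat h𝒜 hext h₂).exists_coresolution
  obtain ⟨Q, h₄, h₅⟩ := h₁.quotient h₃
  exact ⟨h.torZero_mid hA.torZero hD.torZero, F', Q, hF', Or.inl ⟨A', P', hA', hP', h₅⟩, h₄⟩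

/-- Relative Gorenstein flat modules are closed under kernels of surjections. -/
theorem IsGorFlat.kernel (h : SES A B D) (hB : IsGorFlat 𝒜 B) (hD : IsGorFlat 𝒜 D) :
    IsGorFlat 𝒜 A := by
  obtain ⟨D', P, _, hs⟩ := exists_free_cover D
  -- Y is an extension of B by the syzygy D' and contains A with free cokernel P. For Y inside a
  -- flat F, F/A extends F/Y by P, and A is the syzygy of F/A.
  obtain ⟨Y, h₁, h₂⟩ := h.pullback hs
  have hY : IsGorFlat 𝒜 Y := .extension h𝒜 hext h₂ (hD.syzygy hs) hB
  obtain ⟨F, Y', hF, hY', h₃⟩ := hY.exists_coresolution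
  obtain ⟨Q, h₄, h₅⟩ := h₁.quotient h₃
  exact (hY'.extension_of_flat h𝒜 hext h₅).syzygy h₄

/-- A module of relative Gorenstein flat dimension at most one is relative Gorenstein flat if its
`Tor_1` with injective modules vanishes. -/
theorem IsGorFlat.quotient (h : SES A B D) (hA : IsGorFlat 𝒜 A) (hB : IsGorFlat 𝒜 B)
    (hD : ∀ I : ModuleCat.{u} R, Module.Injective R I → ExtZero D (charMod I) 1) : IsGorFlat 𝒜 D := by
  obtain ⟨F, A', hF, hA', hs⟩ := hA.exists_coresolution
  obtain ⟨Z, h₁, h₂⟩ := h.pushout hs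
  obtain ⟨F', Z', hF', hZ', h₃⟩ := (IsGorFlat.extension h𝒜 hext h₁ hB hA').exists_coresolution
  obtain ⟨Q, h₄, h₅⟩ := h₂.quotient h₃
  -- Q = F'/F has flat dimension at most one and contains D with cokernel Z', so the hypothesis on D
  -- makes it flat and D becomes a syzygy of Z'.
  have hQ : Module.Flat R Q := h₄.flat_quotient fun I hI => by
    obtain ⟨f, g, h₅⟩ := h₅
    exact h₅.extZero_mid_left (hD I hI) (hZ'.torZero I (h𝒜 I hI) 0)
  exact hZ'.syzygy h₅

end ExtensionClosed

end RelativeGorensteinFlat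

/-! ### Two-sided exact sequences, splicing, and the comparison with ordinary Gorenstein flatness.
-/

section ExactSequences

variable {R : Type u} [CommRing R]

theorem lTensor_injective_iff_extend {A B : ModuleCat.{u} R} (U : ModuleCat.{u} R)
    (f : A →ₗ[R] B) : Function.Injective (f.lTensor U) ↔
      ∀ φ : A →ₗ[R] charMod U, ∃ ψ : B →ₗ[R] charMod U, ψ ∘ₗ f = φ := by
  rw [LinearMap.lTensor_inj_iff_rTensor_inj, rTensor_injective_iff_lcomp_surjective]
  rfl

theorem IsShortExact.lTensor_injective {A B D U : ModuleCat.{u} R} {f : A →ₗ[R] B}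
    {g : B →ₗ[R] D} (h : IsShortExact f g) (hD : ExtZero D (charMod U) 1) :
    Function.Injective (f.lTensor U) :=
  (lTensor_injective_iff_extend U f).2 (h.exists_extend hD)

theorem IsShortExact.extZero_of_lTensor_injective {A B D U : ModuleCat.{u} R} {f : A →ₗ[R] B}
    {g : B →ₗ[R] D} (h : IsShortExact f g) (hB : ExtZero B (charMod U) 1)
    (hinj : Function.Injective (f.lTensor U)) : ExtZero D (charMod U) 1 :=
  h.extZero_one_of_extend hB ((lTensor_injective_iff_extend U f).1 hinj)

/-- The given element is placed at index 1 because in a spliced sequence the image of the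
differential of index 0 is the cycle module of index 1. -/
theorem exists_int_chain {α : Type*} (r : α → α → Prop) (hf : ∀ a, ∃ b, r a b)
    (hb : ∀ b, ∃ a, r a b) (a : α) : ∃ z : ℤ → α, z 1 = a ∧ ∀ n, r (z n) (z (n + 1)) := by
  choose s hs using hf
  choose p hp using hb
  refine ⟨fun n => match n with
    | Int.ofNat 0 => p a
    | Int.ofNat (k + 1) => s^[k] a
    | Int.negSucc k => p^[k + 2] a, rfl, fun n => ?_⟩
  match n with
  | Int.ofNat 0 => exact hp a
  | Int.ofNat (k + 1) =>
    change r (s^[k] a) (s^[k + 1] a)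
    rw [Function.iterate_succ_apply']
    exact hs _
  | Int.negSucc 0 => exact hp (p a)
  | Int.negSucc (k + 1) =>
    change r (p^[k + 2 + 1] a) (p^[k + 2] a)
    rw [Function.iterate_succ_apply']
    exact hp _

theorem exact_comp_comp {A B X D E : Type*} [Zero D] [Zero E] {s : A → B} {i : B → X} {p : X → D}
    {j : D → E} (hs : Function.Surjective s) (h : Function.Exact i p) (hj : Function.Injective j)
    (hj0 : j 0 = 0) : Function.Exact (i ∘ s) (j ∘ p) := by
  intro x
  rw [hs.range_comp, ← h x, Function.comp_apply, ← hj0, hj.eq_iff]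

namespace ExactSeq

/-- Splicing short exact sequences `0 → Z n → X n → Z (n + 1) → 0`. -/
def splice (Z X : ℤ → ModuleCat.{u} R) (ι : ∀ n, Z n →ₗ[R] X n) (π : ∀ n, X n →ₗ[R] Z (n + 1))
    (h : ∀ n, IsShortExact (ι n) (π n)) : ExactSeq R where
  X := X
  d n := ι (n + 1) ∘ₗ π n
  exact_d n := by
    rw [LinearMap.coe_comp, LinearMap.coe_comp]
    exact exact_comp_comp (h n).2.2 (h (n + 1)).2.1 (h (n + 1 + 1)).1 (map_zero _)

section splice

variable {Z X : ℤ → ModuleCat.{u} R} {ι : ∀ n, Z n →ₗ[R] X n} {π : ∀ n, X n →ₗ[R] Z (n + 1)}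
  (h : ∀ n, IsShortExact (ι n) (π n))

theorem splice_range : Nonempty (Z 1 ≃ₗ[R] LinearMap.range ((splice Z X ι π h).d 0)) := by
  refine ⟨LinearEquiv.ofInjective (ι 1) (h 1).1 ≪≫ₗ LinearEquiv.ofEq _ _ ?_⟩
  exact (LinearMap.range_comp_of_range_eq_top _ (LinearMap.range_eq_top.2 (h 0).2.2)).symm

theorem splice_tensorExact (U : ModuleCat.{u} R)
    (hU : ∀ n, Function.Injective ((ι n).lTensor U)) : (splice Z X ι π h).TensorExact U := by
  intro n
  change Function.Exact ((ι (n + 1) ∘ₗ π n).lTensor U) ((ι (n + 1 + 1) ∘ₗ π (n + 1)).lTensor U)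
  rw [LinearMap.lTensor_comp, LinearMap.lTensor_comp, LinearMap.coe_comp, LinearMap.coe_comp]
  exact exact_comp_comp (LinearMap.lTensor_surjective U (h n).2.2)
    (lTensor_exact U (h (n + 1)).2.1 (h (n + 1)).2.2) (hU (n + 1 + 1)) (map_zero _)

theorem splice_homExact (V : ModuleCat.{u} R)
    (hV : ∀ n, ∀ φ : V →ₗ[R] Z (n + 1), ∃ ψ : V →ₗ[R] X n, π n ∘ₗ ψ = φ) :
    (splice Z X ι π h).HomExact V := by
  intro n φ
  change (ι (n + 1 + 1) ∘ₗ π (n + 1)) ∘ₗ φ = 0 ↔ φ ∈ Set.range fun f => (ι (n + 1) ∘ₗ π n) ∘ₗ f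
  constructor
  · intro hφ
    obtain ⟨t, ht⟩ := exists_lift_of_injective (ι (n + 1)) (h (n + 1)).1 φ (fun x =>
      ((h (n + 1)).2.1 (φ x)).1 ((injective_iff_map_eq_zero _).1 (h (n + 1 + 1)).1 _
        (LinearMap.congr_fun hφ x)))
    obtain ⟨ψ, hψ⟩ := hV n t
    refine ⟨ψ, LinearMap.ext fun x => ?_⟩
    rw [← ht, ← hψ]
    rfl
  · rintro ⟨ψ, rfl⟩
    refine LinearMap.ext fun x => ?_
    simp [(h (n + 1)).2.1.apply_apply_eq_zero]

end splice

variable (S : ExactSeq R)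

/-- The images in an exact sequence. -/
abbrev im (n : ℤ) : ModuleCat.{u} R := ModuleCat.of R (LinearMap.range (S.d n))

theorem isShortExact_im (n : ℤ) : IsShortExact (A := S.im n) (D := S.im (n + 1))
    (LinearMap.range (S.d n)).subtype (S.d (n + 1)).rangeRestrict := by
  refine ⟨Subtype.val_injective, fun x => ?_, LinearMap.surjective_rangeRestrict _⟩
  rw [← Subtype.val_inj, LinearMap.codRestrict_apply]
  refine ((S.exact_d n) x).trans ?_
  simp

variable {S}

/-- An element of U ⊗ im that dies in the next term lifts to a cycle of the tensored sequence, hence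
to a boundary, and boundaries map to zero in U ⊗ im. -/
theorem TensorExact.lTensor_im_injective {U : ModuleCat.{u} R} (hU : S.TensorExact U) (n : ℤ) :
    Function.Injective ((LinearMap.range (S.d n)).subtype.lTensor U) := by
  obtain ⟨m, rfl⟩ : ∃ m, n = m + 1 := ⟨n - 1, by ring⟩
  refine (injective_iff_map_eq_zero _).2 fun x hx => ?_
  obtain ⟨y, rfl⟩ := LinearMap.lTensor_surjective U
    (LinearMap.surjective_rangeRestrict (S.d (m + 1))) x
  rw [← LinearMap.lTensor_comp_apply, LinearMap.subtype_comp_codRestrict] at hx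
  obtain ⟨w, rfl⟩ := (hU m y).1 hx
  rw [← LinearMap.lTensor_comp_apply]
  have : (S.d (m + 1)).rangeRestrict ∘ₗ S.d m = 0 :=
    LinearMap.ext fun z => Subtype.ext ((S.exact_d m).apply_apply_eq_zero z)
  rw [this, LinearMap.lTensor_zero, LinearMap.zero_apply]

end ExactSeq

theorem IsGorFlat.exists_resolution {𝒜 : ModuleCat.{u} R → Prop} {N : ModuleCat.{u} R}
    (h : IsGorFlat 𝒜 N) :
    ∃ K F : ModuleCat.{u} R, Module.Flat R F ∧ IsGorFlat 𝒜 K ∧ SES K F N := by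
  obtain ⟨K, P, _, hs⟩ := exists_free_cover N
  exact ⟨K, P, inferInstance, h.syzygy hs, hs⟩

/-- A relative Gorenstein flat module occurs in a two-sided sequence of such modules. -/
theorem IsGorFlat.exists_chain {𝒜 : ModuleCat.{u} R → Prop} {N : ModuleCat.{u} R}
    (h : IsGorFlat 𝒜 N) : ∃ (Z X : ℤ → ModuleCat.{u} R) (ι : ∀ n, Z n →ₗ[R] X n)
      (π : ∀ n, X n →ₗ[R] Z (n + 1)), Z 1 = N ∧ (∀ n, IsShortExact (ι n) (π n)) ∧
      (∀ n, Module.Flat R (X n)) ∧ ∀ n, IsGorFlat 𝒜 (Z n) := by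
  obtain ⟨z, hz, hr⟩ := exists_int_chain (α := {N : ModuleCat.{u} R // IsGorFlat 𝒜 N})
    (fun A B => ∃ F : ModuleCat.{u} R, Module.Flat R F ∧ SES A.1 F B.1)
    (fun A => by
      obtain ⟨F, N', hF, hN', hs⟩ := A.2.exists_coresolution
      exact ⟨⟨N', hN'⟩, F, hF, hs⟩)
    (fun A => by
      obtain ⟨K, F, hF, hK, hs⟩ := A.2.exists_resolution
      exact ⟨⟨K, hK⟩, F, hF, hs⟩) ⟨N, h⟩
  choose F hF ι π hs using hr
  exact ⟨fun n => (z n).1, F, ι, π, congrArg Subtype.val hz, hs, hF, fun n => (z n).2⟩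

/-- A coinductive chain is spliced into a two-sided sequence. Conversely, all images in the sequence
form the required class: tensor exactness gives Tor_1 = 0 for every image, and higher Tor shifts to
images further left. -/
theorem isGorFlat_injClass_iff (N : ModuleCat.{u} R) :
    IsGorFlat (InjClass R) N ↔ IsGorensteinFlat N := by
  constructor
  · intro h
    obtain ⟨Z, X, ι, π, rfl, hs, hX, hZ⟩ := h.exists_chain
    exact ⟨ExactSeq.splice Z X ι π hs, hX, ExactSeq.splice_range hs, fun I hI =>
      ExactSeq.splice_tensorExact hs I fun n =>
        (hs n).lTensor_injective ((hZ (n + 1)).torZero I hI 0)⟩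
  · rintro ⟨S, hX, ⟨e⟩, hI⟩
    refine ⟨fun N => ∃ n, Nonempty (N ≃ₗ[R] S.im n), ⟨0, ⟨e⟩⟩, ?_⟩
    have key (I : ModuleCat.{u} R) (h : Module.Injective R I) (i : ℕ) :
        ∀ n, ExtZero (S.im n) (charMod I) (i + 1) := by
      induction i with
      | zero =>
        intro n
        obtain ⟨m, rfl⟩ : ∃ m, n = m + 1 := ⟨n - 1, by ring⟩
        exact (S.isShortExact_im m).extZero_of_lTensor_injective
          (have := hX (m + 1); .of_flat _ _ _) ((hI I h).lTensor_im_injective m)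
      | succ i ih =>
        intro n
        obtain ⟨m, rfl⟩ : ∃ m, n = m + 1 := ⟨n - 1, by ring⟩
        exact (S.isShortExact_im m).extZero_quot_left (ih m) (have := hX (m + 1); .of_flat _ _ _)
    rintro X ⟨n, ⟨e⟩⟩
    exact ⟨fun I h i => (key I h i n).congr_left e.symm, S.X (n + 1), S.im (n + 1), hX _,
      ⟨n + 1, ⟨.refl R _⟩⟩, SES.congr ⟨_, _, S.isShortExact_im n⟩ e.symm (.refl R _) (.refl R _)⟩

theorem IsGFClosed.extension (hR : IsGFClosed R) {A B D : ModuleCat.{u} R} (h : SES A B D)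
    (hA : IsGorFlat (InjClass R) A) (hD : IsGorFlat (InjClass R) D) :
    IsGorFlat (InjClass R) B := by
  rw [isGorFlat_injClass_iff] at *
  obtain ⟨f, g, h⟩ := h
  exact hR A B D f g h hA hD

end ExactSequences

/-! ### Tensor and Hom evaluation maps for finitely presented modules. -/

section Evaluation

variable {R : Type u} [CommRing R]

section

variable (C Z F : Type u) [AddCommGroup C] [AddCommGroup Z] [AddCommGroup F]
  [Module R C] [Module R Z] [Module R F]

/-- `Hom(Z, C) ⊗ F → Hom(Z, C ⊗ F)` is bijective for `Z` finitely presented and `F` flat. -/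
theorem homTensor_bijective [Module.FinitePresentation R Z] [Module.Flat R F] :
    Function.Bijective (TensorProduct.rTensorHomToHomRTensor (.id R) Z C F) := by
  obtain ⟨n, m, b, a, hb, hab⟩ := Module.FinitePresentation.exists_fin' R Z
  have hfree (k : ℕ) :
      Function.Bijective (TensorProduct.rTensorHomToHomRTensor (.id R) (Fin k → R) C F) := by
    have := (rTensorHomEquivHomRTensor R (Fin k → R) C F).bijective
    rwa [← LinearEquiv.coe_toLinearMap, rTensorHomEquivHomRTensor_toLinearMap] at this
  refine LinearMap.bijective_of_bijective_of_injective_of_left_exact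
    ((b.lcomp R C).rTensor F) ((a.lcomp R C).rTensor F) (b.lcomp R (C ⊗[R] F))
    (a.lcomp R (C ⊗[R] F)) _ _ (TensorProduct.rTensorHomToHomRTensor (.id R) (Fin m → R) C F)
    ?_ ?_ ?_ ?_ (hfree n) (hfree m).1 ?_ ?_
  · ext; simp
  · ext; simp
  · exact Module.Flat.rTensor_exact F (LinearMap.exact_lcomp_of_exact_of_surjective _ hab hb)
  · exact LinearMap.exact_lcomp_of_exact_of_surjective _ hab hb
  · exact Module.Flat.rTensor_preserves_injective_linearMap _ (LinearMap.lcomp_injective_of_surjective _ hb)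
  · exact LinearMap.lcomp_injective_of_surjective _ hb

end

theorem exact_lcomp_of_injective (I : Type u) {A B D : Type u} [AddCommGroup I] [AddCommGroup A]
    [AddCommGroup B] [AddCommGroup D] [Module R I] [Module R A] [Module R B] [Module R D]
    [Module.Injective R I] {f : A →ₗ[R] B} {g : B →ₗ[R] D} (h : Function.Exact f g) :
    Function.Exact (g.lcomp R I) (f.lcomp R I) := by
  intro l
  constructor
  · intro hl
    obtain ⟨t, ht⟩ := exists_factor_of_surjective g.rangeRestrict g.surjective_rangeRestrict l
      (fun x hx => by
        obtain ⟨a, rfl⟩ := (h x).1 (congrArg Subtype.val hx)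
        exact LinearMap.congr_fun hl a)
    obtain ⟨k, hk⟩ := Module.Injective.out (LinearMap.range g).subtype Subtype.val_injective t
    exact ⟨k, LinearMap.ext fun x => (hk (g.rangeRestrict x)).trans (ht x)⟩
  · rintro ⟨k, rfl⟩
    refine LinearMap.ext fun a => ?_
    simp [h.apply_apply_eq_zero]

section

variable (R) (C I Z : Type u) [AddCommGroup C] [AddCommGroup Z] [AddCommGroup I]
  [Module R C] [Module R Z] [Module R I]

/-- The evaluation `Hom(C, I) ⊗ Z → Hom(Hom(Z, C), I)`. -/
noncomputable def tensorHomEval : (C →ₗ[R] I) ⊗[R] Z →ₗ[R] ((Z →ₗ[R] C) →ₗ[R] I) :=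
  TensorProduct.lift (LinearMap.mk₂ R (fun u z => u ∘ₗ LinearMap.applyₗ z)
    (fun _ _ _ => rfl) (fun _ _ _ => rfl) (fun _ _ _ => by ext; simp) (fun _ _ _ => by ext; simp))

@[simp]
theorem tensorHomEval_tmul (u : C →ₗ[R] I) (z : Z) (h : Z →ₗ[R] C) :
    tensorHomEval R C I Z (u ⊗ₜ z) h = u (h z) := by
  simp [tensorHomEval]

theorem tensorHomEval_bijective_free (n : ℕ) :
    Function.Bijective (tensorHomEval R C I (Fin n → R)) := by
  -- The i-th coordinate embedding of C into Hom(Rⁿ, C) ≅ Cⁿ, sending c to z ↦ z i • c.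
  let p (i : Fin n) : C →ₗ[R] ((Fin n → R) →ₗ[R] C) :=
    LinearMap.smulRightₗ (LinearMap.proj i)
  rw [Function.bijective_iff_has_inverse]
  refine ⟨fun l => ∑ i, (l ∘ₗ p i) ⊗ₜ Pi.single i 1, fun x => ?_, fun l => ?_⟩
  · induction x with
    | zero => simp
    | add x y hx hy =>
      simp only [map_add, LinearMap.add_comp, TensorProduct.add_tmul, Finset.sum_add_distrib] 
      exact congrArg₂ _ hx hy
    | tmul u z =>
      have : ∀ i, tensorHomEval R C I (Fin n → R) (u ⊗ₜ z) ∘ₗ p i = z i • u := fun i => by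
        ext c
        simp [p]
      simp only [this, TensorProduct.smul_tmul, ← TensorProduct.tmul_sum]
      congr 1
      ext i
      simp [Finset.sum_apply, Pi.single_apply]
  · ext h
    simp only [map_sum, LinearMap.sum_apply, tensorHomEval_tmul, LinearMap.comp_apply]
    rw [← map_sum]
    congr 1
    ext i
    simp [p, Pi.single_apply, Finset.sum_apply]

/-- Both sides are right exact in Z, the right-hand one because I is injective, so a finite
presentation reduces to finite free modules. -/
theorem tensorHomEval_bijective [Module.FinitePresentation R Z] [Module.Injective R I] :
    Function.Bijective (tensorHomEval R C I Z) := by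
  obtain ⟨n, m, b, a, hb, hab⟩ := Module.FinitePresentation.exists_fin' R Z
  refine LinearMap.bijective_of_surjective_of_bijective_of_right_exact
    (a.lTensor (C →ₗ[R] I)) (b.lTensor (C →ₗ[R] I)) ((a.lcomp R C).lcomp R I)
    ((b.lcomp R C).lcomp R I) (tensorHomEval R C I _) (tensorHomEval R C I _) _
    ?_ ?_ ?_ ?_ (tensorHomEval_bijective_free R C I m).2 (tensorHomEval_bijective_free R C I n) ?_ ?_
  · ext; simp
  · ext; simp
  · exact lTensor_exact _ hab hb
  · exact exact_lcomp_of_injective I (LinearMap.exact_lcomp_of_exact_of_surjective _ hab hb)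
  · exact LinearMap.lTensor_surjective _ hb
  · intro l
    obtain ⟨k, hk⟩ := Module.Injective.out (b.lcomp R C) (LinearMap.lcomp_injective_of_surjective _ hb) l
    exact ⟨k, LinearMap.ext hk⟩

end

end Evaluation

/-! ### The adjunction between C ⊗ - and Hom(C, -), and its good behaviour on flat and injective
modules. -/

section Foxby

variable {R : Type u} [CommRing R]

/-- The tensor product, as an object of the category of modules. -/
abbrev tens (C N : ModuleCat.{u} R) : ModuleCat.{u} R := ModuleCat.of R (C ⊗[R] N)

/-- The module of homomorphisms, as an object of the category of modules. -/
abbrev homMod (C N : ModuleCat.{u} R) : ModuleCat.{u} R := ModuleCat.of R (C →ₗ[R] N)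

/-- The unit `N → Hom(C, C ⊗ N)` of the adjunction. -/
noncomputable abbrev foxbyUnit (C N : ModuleCat.{u} R) : N →ₗ[R] (C →ₗ[R] C ⊗[R] N) :=
  (TensorProduct.mk R C N).flip

/-- The counit `C ⊗ Hom(C, X) → X` of the adjunction. -/
noncomputable abbrev foxbyCounit (C X : ModuleCat.{u} R) : C ⊗[R] (C →ₗ[R] X) →ₗ[R] X :=
  TensorProduct.lift LinearMap.applyₗ

theorem foxbyCounit_comp_unit (C N : ModuleCat.{u} R) (x : C ⊗[R] N) :
    foxbyCounit C (tens C N) ((foxbyUnit C N).lTensor C x) = x := by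
  induction x with
  | zero => simp
  | add x y hx hy => rw [map_add, map_add, hx, hy]
  | tmul c n => simp

/-- Triangle identity: the counit at C ⊗ N is a left inverse of C ⊗ (unit), which is bijective. -/
theorem foxbyCounit_bijective_of_unit {C N : ModuleCat.{u} R}
    (h : Function.Bijective (foxbyUnit C N)) :
    Function.Bijective (foxbyCounit C (tens C N)) := by
  have hb : Function.Bijective ((foxbyUnit C N).lTensor C) :=
    ((LinearEquiv.ofBijective _ h).lTensor C).bijective
  have hc : foxbyCounit C (tens C N) ∘ (foxbyUnit C N).lTensor C = id :=
    funext (foxbyCounit_comp_unit C N)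
  exact (Function.Bijective.of_comp_iff _ hb).1 (hc ▸ Function.bijective_id)

variable {A B D C N Y Z : ModuleCat.{u} R}

theorem IsShortExact.lTensor {f : A →ₗ[R] B} {g : B →ₗ[R] D} (h : IsShortExact f g)
    (hD : ExtZero D (charMod C) 1) :
    IsShortExact (A := tens C A) (B := tens C B) (D := tens C D) (f.lTensor C) (g.lTensor C) :=
  ⟨h.lTensor_injective hD, lTensor_exact C h.2.1 h.2.2, LinearMap.lTensor_surjective C h.2.2⟩

/-- If `C ⊗ P` is `Ext(-, Y)`-acyclic for free `P`, then the same holds for `C ⊗ N` exactly if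
`N` is `Ext(-, Hom(C, Y))`-acyclic, provided that `Tor_i(C, N) = 0` for `i ≥ 1`. -/
theorem extZero_tens_iff (hY : ∀ P : ModuleCat.{u} R, Module.Free R P → ∀ i,
      ExtZero (tens C P) Y (i + 1)) (hN : ∀ i, ExtZero N (charMod C) (i + 1)) (i : ℕ) :
    ExtZero (tens C N) Y (i + 1) ↔ ExtZero N (homMod C Y) (i + 1) := by
  induction i generalizing N with
  | zero =>
    obtain ⟨K, P, hP, f, g, h⟩ := exists_free_cover N
    constructor
    · intro h0
      refine h.extZero_one_of_extend (.of_projective _ _ 0) fun φ => ?_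
      -- Under the tensor-hom adjunction, extending K → Hom(C, Y) to P is the same as extending C ⊗
      -- K → Y to C ⊗ P; Tor_1(C, N) = 0 keeps the tensored sequence exact.
      obtain ⟨ψ, hψ⟩ := (h.lTensor (hN 0)).exists_extend h0 (TensorProduct.lift φ.flip)
      refine ⟨(TensorProduct.curry ψ).flip, LinearMap.ext fun k => LinearMap.ext fun c => ?_⟩
      exact LinearMap.congr_fun hψ (c ⊗ₜ k)
    · intro h0
      refine (h.lTensor (hN 0)).extZero_one_of_extend (hY P hP 0) fun φ => ?_
      obtain ⟨ψ, hψ⟩ := h.exists_extend h0 (TensorProduct.curry φ).flip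
      refine ⟨TensorProduct.lift ψ.flip, TensorProduct.ext' fun c k => ?_⟩
      exact LinearMap.congr_fun (LinearMap.congr_fun hψ k) c
  | succ i ih =>
    obtain ⟨K, P, hP, f, g, h⟩ := exists_free_cover N
    have hK (i : ℕ) : ExtZero K (charMod C) (i + 1) :=
      h.extZero_sub_left (.of_projective _ _ i) (hN (i + 1))
    constructor
    · intro h0
      exact h.extZero_quot_left ((ih hK).1 ((h.lTensor (hN 0)).extZero_sub_left (hY P hP i) h0))
        (.of_projective _ _ _)
    · intro h0
      exact (h.lTensor (hN 0)).extZero_quot_left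
        ((ih hK).2 (h.extZero_sub_left (.of_projective _ _ _) h0)) (hY P hP (i + 1))

/-- `Z` has a resolution by finitely generated projective modules and `Ext^i(Z, C) = 0` for
`i ≥ 1`. -/
structure IsFinExt (C Z : ModuleCat.{u} R) : Prop where
  resolution : ∃ P : LeftSeq Z, ∀ n, Module.Finite R (P.X n) ∧ Module.Projective R (P.X n)
  extZero : ∀ i, ExtZero Z C (i + 1)

namespace IsFinExt

theorem finitePresentation (hZ : IsFinExt C Z) : Module.FinitePresentation R Z := by
  obtain ⟨P, hP⟩ := hZ.resolution
  have := (hP 0).1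
  have := (hP 0).2
  have := (hP 1).1
  have := Module.finitePresentation_of_projective R (P.X 0)
  refine Module.finitePresentation_of_surjective P.aug P.surjective_aug ?_
  rw [P.exact_aug.linearMap_ker_eq]
  exact Module.Finite.iff_fg.1 inferInstance

/-- Stability under syzygies is the reason for working with a general Z instead of C: the inductions
below pass to the syzygies of C. -/
theorem exists_syzygy (hZ : IsFinExt C Z) : ∃ (Z' P : ModuleCat.{u} R) (f : Z' →ₗ[R] P)
    (g : P →ₗ[R] Z), IsShortExact f g ∧ Module.Finite R P ∧ Module.Projective R P ∧
      IsFinExt C Z' := by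
  obtain ⟨P, hP⟩ := hZ.resolution
  have h : IsShortExact (A := ModuleCat.of R (LinearMap.range (P.d 0)))
      (LinearMap.range (P.d 0)).subtype P.aug :=
    ⟨Subtype.val_injective, fun x => (P.exact_aug x).trans (by simp), P.surjective_aug⟩
  have := (hP 0).2
  refine ⟨_, P.X 0, _, _, h, (hP 0).1, (hP 0).2, ⟨{
    X := fun n => P.X (n + 1)
    d := fun n => P.d (n + 1)
    aug := (P.d 0).rangeRestrict
    exact_d := fun n => P.exact_d (n + 1)
    exact_aug := fun x => by
      rw [← P.exact_d 0 x, ← Subtype.val_inj]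
      rfl
    surjective_aug := (P.d 0).surjective_rangeRestrict }, fun n => hP (n + 1)⟩, fun i => ?_⟩
  exact h.extZero_sub_left (.of_projective _ _ i) (hZ.extZero (i + 1))

/-- `Ext^i(Z, C ⊗ F) = 0` for flat `F`. -/
theorem extZero_tens (hZ : IsFinExt C Z) (F : ModuleCat.{u} R) [Module.Flat R F] (i : ℕ) :
    ExtZero Z (tens C F) (i + 1) := by
  induction i generalizing Z with
  | zero =>
    obtain ⟨Z', P, f, g, h, _, _, hZ'⟩ := hZ.exists_syzygy
    have := hZ'.finitePresentation
    refine h.extZero_one_of_extend (.of_projective _ _ 0) fun φ => ?_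
    -- The map becomes an element of Hom(Z', C) ⊗ F, and Hom(P, C) → Hom(Z', C) is onto since
    -- Ext¹(Z, C) = 0.
    obtain ⟨x, rfl⟩ := (homTensor_bijective C Z' F).2 φ
    have hs : Function.Surjective (f.lcomp R C) := h.exists_extend (hZ.extZero 0)
    obtain ⟨y, rfl⟩ := LinearMap.rTensor_surjective F hs x
    refine ⟨TensorProduct.rTensorHomToHomRTensor (.id R) P C F y, ?_⟩
    induction y with
    | zero => simp
    | add x y hx hy => rw [map_add, map_add, map_add, ← hx, ← hy, LinearMap.add_comp]
    | tmul u x => ext; simp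
  | succ i ih =>
    obtain ⟨Z', P, f, g, h, _, _, hZ'⟩ := hZ.exists_syzygy
    exact h.extZero_quot_left (ih hZ') (.of_projective _ _ _)

/-- The evaluation isomorphism turns Hom(C, I) ⊗ f into Hom(f^*, I) with f^* : Hom(P, C) → Hom(Z',
C), which is injective because f^* is surjective. -/
theorem lTensor_injective {I Z' P : ModuleCat.{u} R} [Module.Injective R I]
    (hZ' : IsFinExt C Z') {f : Z' →ₗ[R] P} (hs : Function.Surjective (f.lcomp R C)) :
    Function.Injective (f.lTensor (C →ₗ[R] I)) := by
  have := hZ'.finitePresentation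
  have hnat (x) : tensorHomEval R C I P (f.lTensor _ x) = tensorHomEval R C I Z' x ∘ₗ f.lcomp R C := by
    induction x with
    | zero => simp
    | add x y hx hy => simp only [map_add, hx, hy, LinearMap.add_comp]
    | tmul u x => ext; simp
  refine (injective_iff_map_eq_zero _).2 fun x hx => ?_
  refine (injective_iff_map_eq_zero _).1 (tensorHomEval_bijective R C I Z').1 x ?_
  refine LinearMap.ext fun k => ?_
  obtain ⟨k, rfl⟩ := hs k
  rw [← LinearMap.comp_apply, ← hnat, hx, map_zero]
  rfl

/-- `Tor_i(Hom(C, I), Z ⊗ F) = 0` for injective `I` and flat `F`. -/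
theorem extZero_charMod (hZ : IsFinExt C Z) (I F : ModuleCat.{u} R) [Module.Injective R I]
    [Module.Flat R F] (i : ℕ) : ExtZero (tens Z F) (charMod (homMod C I)) (i + 1) := by
  have key {Z Z' P : ModuleCat.{u} R} {f : Z' →ₗ[R] P} {g : P →ₗ[R] Z} (h : IsShortExact f g) :
      IsShortExact (A := tens Z' F) (B := tens P F) (D := tens Z F) (f.rTensor F) (g.rTensor F) :=
    ⟨Module.Flat.rTensor_preserves_injective_linearMap f h.1, rTensor_exact F h.2.1 h.2.2,
      LinearMap.rTensor_surjective F h.2.2⟩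
  induction i generalizing Z with
  | zero =>
    obtain ⟨Z', P, f, g, h, _, _, hZ'⟩ := hZ.exists_syzygy
    refine (key h).extZero_of_lTensor_injective (.of_flat (tens P F) _ 0) ?_
    have hinj := Module.Flat.rTensor_preserves_injective_linearMap (M := F) _
      (hZ'.lTensor_injective (I := I) (h.exists_extend (hZ.extZero 0)))
    -- Reassociating moves F outside, where its flatness preserves the injectivity already known for
    -- Hom(C, I) ⊗ f.
    have hcomm : (f.rTensor F).lTensor (C →ₗ[R] I) ∘ₗ (TensorProduct.assoc R _ _ _).toLinearMap =
        (TensorProduct.assoc R _ _ _).toLinearMap ∘ₗ (f.lTensor (C →ₗ[R] I)).rTensor F :=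
      TensorProduct.ext_threefold fun _ _ _ => rfl
    have hinj' : Function.Injective ((f.rTensor F).lTensor (C →ₗ[R] I) ∘ₗ
        (TensorProduct.assoc R (C →ₗ[R] I) Z' F).toLinearMap) := by
      rw [hcomm]
      exact (TensorProduct.assoc R _ _ _).injective.comp hinj
    exact (Function.Injective.of_comp_iff' _ (TensorProduct.assoc R _ _ _).bijective).1 hinj'
  | succ i ih =>
    obtain ⟨Z', P, f, g, h, _, _, hZ'⟩ := hZ.exists_syzygy
    exact (key h).extZero_quot_left (ih hZ') (.of_flat (tens P F) _ _)

end IsFinExt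

namespace IsSemidualizing

variable (hC : IsSemidualizing C)

include hC

theorem isFinExt : IsFinExt C C :=
  ⟨hC.finite_resolution, fun i => hC.ext_eq_zero (i + 1) (Nat.le_add_left 1 i)⟩

/-- The unit is the composite F ≅ R ⊗ F ≅ Hom(C, C) ⊗ F ≅ Hom(C, C ⊗ F). -/
theorem foxbyUnit_bijective_of_flat (F : ModuleCat.{u} R) [Module.Flat R F] :
    Function.Bijective (foxbyUnit C F) := by
  have := hC.isFinExt.finitePresentation
  have h : foxbyUnit C F = TensorProduct.rTensorHomToHomRTensor (.id R) C C F ∘ₗ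
      (LinearMap.lsmul R C).rTensor F ∘ₗ (TensorProduct.lid R F).symm.toLinearMap := by
    ext; simp
  rw [h]
  exact (homTensor_bijective C C F).comp
    ((((LinearEquiv.ofBijective _ hC.homothety).rTensor F).bijective).comp
      (TensorProduct.lid R F).symm.bijective)

/-- `Hom(C, I) ⊗ C ≅ I` for injective `I`. -/
theorem homMod_tensor_equiv (I : ModuleCat.{u} R) [Module.Injective R I] :
    Nonempty ((C ⊗[R] (C →ₗ[R] I)) ≃ₗ[R] I) := by
  have := hC.isFinExt.finitePresentation
  refine ⟨TensorProduct.comm R _ _ ≪≫ₗ LinearEquiv.ofBijective _ (tensorHomEval_bijective R C I C) ≪≫ₗ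
    ((LinearEquiv.ofBijective _ hC.homothety).congrLeft I R).symm ≪≫ₗ
    LinearMap.ringLmapEquivSelf R R I⟩

/-- By adjunction the left side is (C ⊗ Hom(C, I))⁺, and C ⊗ Hom(C, I) ≅ I. -/
theorem homMod_charMod_equiv (I : ModuleCat.{u} R) [Module.Injective R I] :
    Nonempty (homMod C (charMod (homMod C I)) ≃ₗ[R] charMod I) := by
  obtain ⟨e⟩ := hC.homMod_tensor_equiv I
  exact ⟨CharacterModule.homEquiv ≪≫ₗ CharacterModule.congr e⟩

end IsSemidualizing

end Foxby

/-! ### C detects zero modules, and lifting of maps out of C. -/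

section Faithful

variable {R : Type u} [CommRing R]

/-- A finitely generated faithful module admits nonzero homomorphisms to every nonzero module. -/
theorem subsingleton_of_hom_eq_zero {C Y : Type*} [AddCommGroup C] [Module R C] [AddCommGroup Y]
    [Module R Y] [Module.Finite R C] (hC : ∀ r : R, (∀ c : C, r • c = 0) → r = 0)
    (hY : ∀ f : C →ₗ[R] Y, f = 0) : Subsingleton Y := by
  obtain ⟨n, p, hp⟩ := Module.Finite.exists_fin' R C
  refine subsingleton_of_forall_eq 0 fun y => ?_
  -- By the adjugate identity, det v times each basis vector is a combination of the rows of v,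
  -- hence lies in the kernel of p; so det v annihilates C and vanishes by faithfulness.
  have hdet (v : Matrix (Fin n) (Fin n) R) (hv : ∀ i, p (v i) = 0) : v.det = 0 := by
    refine hC _ fun c => ?_
    obtain ⟨w, rfl⟩ := hp c
    have hz : v.det • p = 0 := by
      refine LinearMap.pi_ext' fun k => LinearMap.ext_ring ?_
      have : v.det • Pi.single k (1 : R) = ∑ i, v.adjugate k i • v i := by
        ext j
        have := congrFun (congrFun v.adjugate_mul k) j
        rw [Matrix.mul_apply] at this
        simp only [Finset.sum_apply, Pi.smul_apply, smul_eq_mul, this]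
        simp [Matrix.one_apply, Pi.single_apply, eq_comm]
      simp [← map_smul, this, hv]
    exact LinearMap.congr_fun hz w
  -- Fewer and fewer rows are required to lie in ker p. With the other rows fixed, w ↦ det(row j :=
  -- w) • y kills ker p by the case j + 1, so it factors through a map C → Y, which is zero.
  have key (j : ℕ) (hj : j ≤ n) : ∀ v : Fin n → Fin n → R,
      (∀ i : Fin n, (i : ℕ) < j → p (v i) = 0) → Matrix.detRowAlternating v • y = 0 := by
    induction hj using Nat.decreasingInduction with
    | self =>
      intro v hv
      exact (congrArg (· • y) (hdet v fun i => hv i i.2)).trans (zero_smul R y)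
    | of_succ j hj ih =>
      intro v hv
      let l : (Fin n → R) →ₗ[R] Y := (LinearMap.toSpanSingleton R Y y) ∘ₗ
        (Matrix.detRowAlternating.toMultilinearMap.toLinearMap v ⟨j, hj⟩)
      have hl' (w : Fin n → R) :
          l w = Matrix.detRowAlternating (Function.update v ⟨j, hj⟩ w) • y := rfl
      obtain ⟨t, ht⟩ := exists_factor_of_surjective p hp l fun x hx => by
        refine ih _ fun i hi => ?_
        rcases eq_or_ne i ⟨j, hj⟩ with rfl | hne
        · rw [Function.update_self, hx]
        · rw [Function.update_of_ne hne]
          exact hv i (lt_of_le_of_ne (Nat.lt_succ_iff.1 hi) fun h => hne (Fin.ext h))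
      have hl := ht (v ⟨j, hj⟩)
      rwa [hY t, LinearMap.zero_apply, hl', Function.update_eq_self, eq_comm] at hl
  -- No row condition is left, so the identity matrix gives 1 • y = 0.
  have h1 := key 0 (Nat.zero_le n) (1 : Matrix (Fin n) (Fin n) R) (by simp)
  exact (one_smul R y).symm.trans ((congrArg (· • y) Matrix.det_one).symm.trans h1)

variable {C : ModuleCat.{u} R}

/-- (C ⊗ X)⁺ ≅ Hom(C, X⁺), and C is finitely generated and faithful by injectivity of the homothety
map; so X⁺ = 0 and X = 0. -/
theorem IsSemidualizing.subsingleton_of_tensor (hC : IsSemidualizing C) (X : ModuleCat.{u} R)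
    [Subsingleton (C ⊗[R] X)] : Subsingleton X := by
  have := hC.isFinExt.finitePresentation
  have h : Subsingleton (CharacterModule X) := by
    refine subsingleton_of_hom_eq_zero (R := R) (C := C) (fun r hr => hC.homothety.1 ?_) fun f => ?_
    · rw [map_zero]
      exact LinearMap.ext hr
    · refine CharacterModule.homEquiv.injective (DFunLike.ext _ _ fun x => ?_)
      rw [Subsingleton.elim x 0, map_zero, map_zero]
  refine subsingleton_of_forall_eq 0 fun x => CharacterModule.eq_zero_of_character_apply fun c => ?_
  rw [Subsingleton.elim c 0]
  rfl

variable {A B D G G' : ModuleCat.{u} R}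

theorem foxbyCounit_naturality (g : B →ₗ[R] D) (x : C ⊗[R] (C →ₗ[R] B)) :
    foxbyCounit C D ((g.compRight R).lTensor C x) = g (foxbyCounit C B x) := by
  induction x with
  | zero => simp
  | add x y hx hy => simp only [map_add, hx, hy]
  | tmul c h => simp

/-- The counits show that C ⊗ Hom(C, g) is surjective, so C kills the cokernel of Hom(C, g), which
is therefore zero. This replaces Ext¹(C, ker g) = 0 where the kernel is not yet understood. -/
theorem IsSemidualizing.exists_lift (hC : IsSemidualizing C)
    (hB : Function.Surjective (foxbyCounit C B)) (hD : Function.Injective (foxbyCounit C D))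
    {g : B →ₗ[R] D} (hg : Function.Surjective g) (φ : C →ₗ[R] D) :
    ∃ ψ : C →ₗ[R] B, g ∘ₗ ψ = φ := by
  have hs : Function.Surjective ((g.compRight R).lTensor C : C ⊗[R] (C →ₗ[R] B) →ₗ[R] _) := by
    intro y
    obtain ⟨b, hb⟩ := hg (foxbyCounit C D y)
    obtain ⟨x, rfl⟩ := hB b
    exact ⟨x, hD (by rw [foxbyCounit_naturality, hb])⟩
  let N := LinearMap.range (g.compRight R : (C →ₗ[R] B) →ₗ[R] (C →ₗ[R] D))
  have : Subsingleton (C ⊗[R] ModuleCat.of R ((C →ₗ[R] D) ⧸ N)) := by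
    refine subsingleton_of_forall_eq 0 fun z => ?_
    obtain ⟨y, rfl⟩ := LinearMap.lTensor_surjective C N.mkQ_surjective z
    obtain ⟨x, rfl⟩ := hs y
    rw [← LinearMap.lTensor_comp_apply, LinearMap.range_mkQ_comp, LinearMap.lTensor_zero,
      LinearMap.zero_apply]
  have := hC.subsingleton_of_tensor (ModuleCat.of R ((C →ₗ[R] D) ⧸ N))
  exact (Submodule.Quotient.mk_eq_zero N).1 (Subsingleton.elim (N.mkQ φ) 0)

theorem IsShortExact.hom {f : A →ₗ[R] B} {g : B →ₗ[R] D} (h : IsShortExact f g)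
    (hl : ∀ φ : C →ₗ[R] D, ∃ ψ : C →ₗ[R] B, g ∘ₗ ψ = φ) :
    IsShortExact (A := homMod C A) (B := homMod C B) (D := homMod C D)
      (f.compRight R) (g.compRight R) := by
  refine ⟨fun x y hxy => LinearMap.ext fun c => h.1 (LinearMap.congr_fun hxy c), fun x => ?_, hl⟩
  constructor
  · intro hx
    obtain ⟨t, ht⟩ := exists_lift_of_injective f h.1 x
      (fun c => (h.2.1 (x c)).1 (LinearMap.congr_fun hx c))
    exact ⟨t, LinearMap.ext ht⟩
  · rintro ⟨y, rfl⟩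
    exact LinearMap.ext fun c => h.2.1.apply_apply_eq_zero (y c)

end Faithful

/-! ### G(W_F) corresponds to relative Gorenstein flat modules under the Foxby adjunction. -/

section Characterization

variable {R : Type u} [CommRing R] {C : ModuleCat.{u} R}

/-- The injective modules together with `C`. -/
def TestClass (C A : ModuleCat.{u} R) : Prop := Module.Injective R A ∨ A = C

variable {A B D M N N' V W U : ModuleCat.{u} R}

theorem foxbyCounit_bijective_congr (e : B ≃ₗ[R] D) (h : Function.Bijective (foxbyCounit C B)) :
    Function.Bijective (foxbyCounit C D) := by
  have hc : foxbyCounit C D ∘ (e.toLinearMap.compRight R).lTensor C = e ∘ foxbyCounit C B :=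
    funext (foxbyCounit_naturality e.toLinearMap)
  have hb : Function.Bijective
      ((e.toLinearMap.compRight R : (C →ₗ[R] B) →ₗ[R] (C →ₗ[R] D)).lTensor C) :=
    ((e.congrRight (M := C)).lTensor C).bijective
  exact (Function.Bijective.of_comp_iff _ hb).1 (hc ▸ e.bijective.comp h)

namespace IsSemidualizing

variable (hC : IsSemidualizing C)

include hC

theorem extZero_of_isCFlat (hW : IsCFlat C W) (i : ℕ) : ExtZero C W (i + 1) := by
  obtain ⟨F, hF, ⟨e⟩⟩ := hW
  exact (hC.isFinExt.extZero_tens F i).congr_right e.symm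

theorem foxbyCounit_bijective_of_isCFlat (hW : IsCFlat C W) :
    Function.Bijective (foxbyCounit C W) := by
  obtain ⟨F, hF, ⟨e⟩⟩ := hW
  exact foxbyCounit_bijective_congr (B := tens C F) e.symm
    (foxbyCounit_bijective_of_unit (hC.foxbyUnit_bijective_of_flat F))

theorem flat_homMod (hW : IsCFlat C W) : Module.Flat R (C →ₗ[R] W) := by
  obtain ⟨F, hF, ⟨e⟩⟩ := hW
  exact Module.Flat.of_linearEquiv (e.congrRight ≪≫ₗ
    (LinearEquiv.ofBijective _ (hC.foxbyUnit_bijective_of_flat F)).symm)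

theorem extZero_charMod_of_isCFlat (hW : IsCFlat C W) (hU : IsCInjective C U) (i : ℕ) :
    ExtZero W (charMod U) (i + 1) := by
  obtain ⟨F, hF, ⟨e⟩⟩ := hW
  obtain ⟨I, hI, ⟨e'⟩⟩ := hU
  exact ((hC.isFinExt.extZero_charMod I F i).congr_left e.symm).congr_right
    (B := charMod U) (CharacterModule.congr e'.symm)

/-- Transfer of `Tor`-vanishing between `C ⊗ N` and `N`. -/
theorem extZero_tens_charMod_iff (hN : ∀ i, ExtZero N (charMod C) (i + 1)) (I : ModuleCat.{u} R)
    [Module.Injective R I] (i : ℕ) :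
    ExtZero (tens C N) (charMod (homMod C I)) (i + 1) ↔ ExtZero N (charMod I) (i + 1) := by
  rw [extZero_tens_iff (fun P _ i => hC.isFinExt.extZero_charMod I P i) hN]
  obtain ⟨e⟩ := hC.homMod_charMod_equiv I
  exact ⟨fun h => h.congr_right e, fun h => h.congr_right e.symm⟩

end IsSemidualizing

theorem foxbyUnit_naturality (f : A →ₗ[R] B) (x : A) :
    f.lTensor C ∘ₗ foxbyUnit C A x = foxbyUnit C B (f x) := by
  ext; simp

theorem IsGorFlat.foxbyUnit_injective (hC : IsSemidualizing C) {𝒜 : ModuleCat.{u} R → Prop}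
    (h : IsGorFlat 𝒜 N) : Function.Injective (foxbyUnit C N) := by
  obtain ⟨F, N', hF, -, f, g, hs⟩ := h.exists_coresolution
  refine (injective_iff_map_eq_zero _).2 fun x hx => ?_
  apply (injective_iff_map_eq_zero _).1 hs.1
  apply (injective_iff_map_eq_zero _).1 (hC.foxbyUnit_bijective_of_flat F).1
  rw [← foxbyUnit_naturality, hx, LinearMap.comp_zero]

/-- A map C → C ⊗ N ⊆ C ⊗ F comes from some y in F; since the unit of N' is injective, y dies in N'
and hence lies in N. The inclusion into C ⊗ F uses Tor_1(C, N') = 0. -/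
theorem IsGorFlat.foxbyUnit_bijective (hC : IsSemidualizing C) (h : IsGorFlat (TestClass C) N) :
    Function.Bijective (foxbyUnit C N) := by
  refine ⟨h.foxbyUnit_injective hC, fun l => ?_⟩
  obtain ⟨F, N', hF, hN', f, g, hs⟩ := h.exists_coresolution
  have ht := hs.lTensor (hN'.torZero C (Or.inr rfl) 0)
  obtain ⟨y, hy⟩ := (hC.foxbyUnit_bijective_of_flat F).2 (f.lTensor C ∘ₗ l)
  obtain ⟨x, rfl⟩ := (hs.2.1 y).1 (by
    apply (injective_iff_map_eq_zero _).1 (hN'.foxbyUnit_injective hC)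
    rw [← foxbyUnit_naturality, hy]
    exact LinearMap.ext fun c => ht.2.1.apply_apply_eq_zero (l c))
  refine ⟨x, LinearMap.ext fun c => ht.1 ?_⟩
  rw [← foxbyUnit_naturality] at hy
  exact LinearMap.congr_fun hy c

/-- Lifting along a map that is surjective after applying `Hom(C, -)`. -/
theorem IsCProjective.exists_lift (hV : IsCProjective C V) {g : B →ₗ[R] D}
    (hg : ∀ φ : C →ₗ[R] D, ∃ ψ : C →ₗ[R] B, g ∘ₗ ψ = φ) (φ : V →ₗ[R] D) :
    ∃ ψ : V →ₗ[R] B, g ∘ₗ ψ = φ := by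
  obtain ⟨P, hP, ⟨e⟩⟩ := hV
  obtain ⟨ψ, hψ⟩ := Module.projective_lifting_property (g.compRight R)
    (TensorProduct.curry (φ ∘ₗ e.symm.toLinearMap)).flip hg
  refine ⟨TensorProduct.lift ψ.flip ∘ₗ e.toLinearMap, ?_⟩
  have : g ∘ₗ TensorProduct.lift ψ.flip = φ ∘ₗ e.symm.toLinearMap :=
    TensorProduct.ext' fun c p => LinearMap.congr_fun (LinearMap.congr_fun hψ p) c
  rw [← LinearMap.comp_assoc, this, LinearMap.comp_assoc]
  ext; simp

/-- Tensor a two-sided flat chain with C. Tor_1(C, -) = 0 keeps it exact, bijective units give the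
Hom(C, -) lifts, and the Tor transfer gives exactness against C-injectives. -/
theorem IsGorFlat.isWFGorenstein (hC : IsSemidualizing C) (h : IsGorFlat (TestClass C) N)
    (e : M ≃ₗ[R] C ⊗[R] N) : IsWFGorenstein C M := by
  obtain ⟨Z, X, ι, π, rfl, hs, hX, hZ⟩ := h.exists_chain
  have ht (n : ℤ) := (hs n).lTensor ((hZ (n + 1)).torZero C (Or.inr rfl) 0)
  refine ⟨ExactSeq.splice (fun n => tens C (Z n)) (fun n => tens C (X n)) _ _ ht,
    fun n => ⟨X n, hX n, ⟨.refl R _⟩⟩, ⟨e ≪≫ₗ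
      (ExactSeq.splice_range (Z := fun n => tens C (Z n)) (X := fun n => tens C (X n)) ht).some⟩,
    fun V hV => ExactSeq.splice_homExact ht V fun n => hV.exists_lift fun φ => ?_,
    fun U hU => ExactSeq.splice_tensorExact ht U fun n => ?_⟩
  · obtain ⟨z, rfl⟩ := ((hZ (n + 1)).foxbyUnit_bijective hC).2 φ
    obtain ⟨x, rfl⟩ := (hs n).2.2 z
    exact ⟨_, foxbyUnit_naturality _ x⟩
  · obtain ⟨I, hI, ⟨e⟩⟩ := hU
    refine (ht n).lTensor_injective (ExtZero.congr_right (A := charMod (homMod C I))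
      (CharacterModule.congr e.symm) ?_)
    exact (hC.extZero_tens_charMod_iff ((hZ (n + 1)).torZero C (Or.inr rfl)) I 0).2
      ((hZ (n + 1)).torZero I (Or.inl hI) 0)

theorem isCProjective_self (C : ModuleCat.{u} R) : IsCProjective C C :=
  ⟨ModuleCat.of R R, inferInstanceAs (Module.Projective R R), ⟨(TensorProduct.rid R C).symm⟩⟩

theorem isCInjective_homMod (C I : ModuleCat.{u} R) [Module.Injective R I] :
    IsCInjective C (homMod C I) :=
  ⟨I, inferInstance, ⟨.refl R _⟩⟩

/-- The description of the class `G(W_F)` through Foxby equivalence. -/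
structure IsFoxbyGorFlat (C M : ModuleCat.{u} R) : Prop where
  extZero : ∀ i, ExtZero C M (i + 1)
  counit : Function.Bijective (foxbyCounit C M)
  gorFlat : IsGorFlat (TestClass C) (homMod C M)

theorem IsFoxbyGorFlat.congr (e : M ≃ₗ[R] N) (h : IsFoxbyGorFlat C M) : IsFoxbyGorFlat C N :=
  ⟨fun i => (h.extZero i).congr_right e, foxbyCounit_bijective_congr e h.counit,
    h.gorFlat.congr (N := homMod C M) (N' := homMod C N) e.congrRight⟩

theorem IsWFGorenstein.isFoxbyGorFlat (hC : IsSemidualizing C) (h : IsWFGorenstein C M) :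
    IsFoxbyGorFlat C M := by
  obtain ⟨S, hX, ⟨e⟩, hV, hU⟩ := h
  have hs := S.isShortExact_im
  -- Only Hom-exactness for V = C is needed; it makes every Hom(C, -) of the short sequences of
  -- images exact.
  have hl (n : ℤ) (φ : C →ₗ[R] S.im (n + 1)) :
      ∃ ψ : C →ₗ[R] S.X (n + 1), (S.d (n + 1)).rangeRestrict ∘ₗ ψ = φ := by
    obtain ⟨ψ, hψ⟩ := (hV C (isCProjective_self C) (n + 1)
      ((LinearMap.range (S.d (n + 1))).subtype ∘ₗ φ)).1
      (LinearMap.ext fun c => by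
        obtain ⟨x, hx⟩ := (φ c).2
        change S.d (n + 1 + 1) (φ c).1 = 0
        rw [← hx]
        exact (S.exact_d (n + 1)).apply_apply_eq_zero x)
    exact ⟨ψ, LinearMap.ext fun c => Subtype.ext (LinearMap.congr_fun hψ c)⟩
  have hh (n : ℤ) := (hs n).hom (hl n)
  have hpred (n : ℤ) : ∃ m, n = m + 1 := ⟨n - 1, by ring⟩
  have hext (i : ℕ) : ∀ n, ExtZero C (S.im n) (i + 1) := by
    induction i with
    | zero => exact fun n => (hs n).extZero_one_of_lift (hC.extZero_of_isCFlat (hX _) 0) (hl n)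
    | succ i ih =>
      exact fun n => (hs n).extZero_sub_right (ih (n + 1)) (hC.extZero_of_isCFlat (hX _) (i + 1))
  have hsurj (n : ℤ) : Function.Surjective (foxbyCounit C (S.im n)) := by
    obtain ⟨m, rfl⟩ := hpred n
    intro z
    obtain ⟨x, rfl⟩ := (hs m).2.2 z
    obtain ⟨y, rfl⟩ := (hC.foxbyCounit_bijective_of_isCFlat (hX (m + 1))).2 x
    exact ⟨_, foxbyCounit_naturality (D := S.im (m + 1)) (S.d (m + 1)).rangeRestrict y⟩
  -- Four lemma, comparing the image sequence with C ⊗ Hom(C, -) of it; surjectivity at the image on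
  -- the left was obtained first for this purpose.
  have hbij (n : ℤ) : Function.Bijective (foxbyCounit C (S.im n)) := by
    refine ⟨?_, hsurj n⟩
    obtain ⟨m, rfl⟩ := hpred n
    refine LinearMap.injective_of_surjective_of_injective_of_right_exact
      _ _ (LinearMap.range (S.d m)).subtype (S.d (m + 1)).rangeRestrict _ _ _ ?_ ?_
      (lTensor_exact C (hh m).2.1 (hh m).2.2) (hs m).2.1 (hsurj m)
      (hC.foxbyCounit_bijective_of_isCFlat (hX (m + 1))).1
      (LinearMap.lTensor_surjective C (hh m).2.2)
    · exact LinearMap.ext fun x =>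
        (foxbyCounit_naturality (B := S.im m) (LinearMap.range (S.d m)).subtype x).symm
    · exact LinearMap.ext fun x =>
        (foxbyCounit_naturality (D := S.im (m + 1)) (S.d (m + 1)).rangeRestrict x).symm
  -- Through the counits, C ⊗ Hom(C, im) → C ⊗ Hom(C, X) becomes the inclusion im ⊆ X. Its
  -- injectivity is the vanishing of Tor_1(C, -) on the next image.
  have htor (i : ℕ) : ∀ n, ExtZero (homMod C (S.im n)) (charMod C) (i + 1) := by
    induction i with
    | zero =>
      intro n
      obtain ⟨m, rfl⟩ := hpred n
      refine (hh m).extZero_of_lTensor_injective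
        (have := hC.flat_homMod (hX (m + 1)); .of_flat (homMod C (S.X (m + 1))) C 0) ?_
      intro x y hxy
      apply (hbij m).1
      apply (hs m).1
      rw [← foxbyCounit_naturality (B := S.im m), ← foxbyCounit_naturality (B := S.im m)]
      exact congrArg _ hxy
    | succ i ih =>
      intro n
      obtain ⟨m, rfl⟩ := hpred n
      exact (hh m).extZero_quot_left (ih m)
        (have := hC.flat_homMod (hX (m + 1)); .of_flat (homMod C (S.X (m + 1))) C _)
  have htorU (I : ModuleCat.{u} R) (hI : Module.Injective R I) (i : ℕ) :
      ∀ n, ExtZero (S.im n) (charMod (homMod C I)) (i + 1) := by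
    have hI' : IsCInjective C (homMod C I) := isCInjective_homMod C I
    induction i with
    | zero =>
      intro n
      obtain ⟨m, rfl⟩ := hpred n
      exact (hs m).extZero_of_lTensor_injective (hC.extZero_charMod_of_isCFlat (hX _) hI' 0)
        ((hU _ hI').lTensor_im_injective m)
    | succ i ih =>
      intro n
      obtain ⟨m, rfl⟩ := hpred n
      exact (hs m).extZero_quot_left (ih m) (hC.extZero_charMod_of_isCFlat (hX _) hI' _)
  -- The modules Hom(C, im) over all indices form the coinductive class, with flat terms Hom(C, X).
  refine IsFoxbyGorFlat.congr (M := S.im 0) e.symm ⟨fun i => hext i 0, hbij 0,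
    fun Y => ∃ n, Nonempty (Y ≃ₗ[R] homMod C (S.im n)), ⟨0, ⟨.refl R _⟩⟩, ?_⟩
  rintro Y ⟨n, ⟨e⟩⟩
  refine ⟨TorZero.congr (N := homMod C (S.im n)) e.symm ?_, homMod C (S.X (n + 1)),
    homMod C (S.im (n + 1)), hC.flat_homMod (hX _), ⟨n + 1, ⟨.refl R _⟩⟩,
    SES.congr ⟨_, _, hh n⟩ e.symm (.refl R _) (.refl R _)⟩
  rintro A (hA | rfl) i
  · refine (hC.extZero_tens_charMod_iff (fun i => htor i n) A i).1 ?_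
    exact (htorU A hA i n).congr_left (LinearEquiv.ofBijective _ (hbij n)).symm
  · exact htor i n

end Characterization

/-! ### Closure properties of G(W_F). -/

section Closure

variable {R : Type u} [CommRing R] {C : ModuleCat.{u} R}

variable {A B D K G G' M N U V W : ModuleCat.{u} R}

theorem IsCFlat.congr (e : M ≃ₗ[R] N) (h : IsCFlat C M) : IsCFlat C N := by
  obtain ⟨F, hF, ⟨e'⟩⟩ := h
  exact ⟨F, hF, ⟨e.symm ≪≫ₗ e'⟩⟩

theorem IsCProjective.isCFlat (h : IsCProjective C V) : IsCFlat C V := by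
  obtain ⟨P, hP, e⟩ := h
  exact ⟨P, inferInstance, e⟩

theorem IsCFlat.of_subsingleton (C M : ModuleCat.{u} R) [Subsingleton M] : IsCFlat C M :=
  ⟨ModuleCat.of R PUnit, inferInstance, ⟨{
    toFun := fun _ => 0
    invFun := fun _ => 0
    map_add' := by simp
    map_smul' := by simp
    left_inv := fun _ => Subsingleton.elim _ _
    right_inv := fun x => by
      induction x with
      | zero => rfl
      | add x y hx hy => rw [← hx, ← hy, add_zero]
      | tmul c x => rw [Subsingleton.elim x 0, TensorProduct.tmul_zero] }⟩⟩

theorem IsWFGorenstein.congr (e : M ≃ₗ[R] N) (h : IsWFGorenstein C M) : IsWFGorenstein C N := by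
  obtain ⟨S, hX, ⟨e'⟩, h⟩ := h
  exact ⟨S, hX, ⟨e.symm ≪≫ₗ e'⟩, h⟩

section

variable (hC : IsSemidualizing C)

include hC

theorem IsCFlat.isWFGorenstein (h : IsCFlat C W) : IsWFGorenstein C W := by
  obtain ⟨F, hF, ⟨e⟩⟩ := h
  exact (IsGorFlat.of_flat F).isWFGorenstein hC e

theorem IsWFGorenstein.exists_tens (h : IsWFGorenstein C M) :
    ∃ N : ModuleCat.{u} R, IsGorFlat (TestClass C) N ∧ Nonempty (M ≃ₗ[R] tens C N) :=
  ⟨_, (h.isFoxbyGorFlat hC).gorFlat,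
    ⟨(LinearEquiv.ofBijective _ (h.isFoxbyGorFlat hC).counit).symm⟩⟩

/-- `Tor_i(U, M) = 0` for `C`-injective `U`, `M` in `G(W_F)` and `i ≥ 1`. -/
theorem IsWFGorenstein.extZero_charMod (h : IsWFGorenstein C M) (hU : IsCInjective C U) (i : ℕ) :
    ExtZero M (charMod U) (i + 1) := by
  obtain ⟨N, hN, ⟨e⟩⟩ := h.exists_tens hC
  obtain ⟨I, hI, ⟨e'⟩⟩ := hU
  exact (((hC.extZero_tens_charMod_iff (hN.torZero C (Or.inr rfl)) I i).2
    (hN.torZero I (Or.inl hI) i)).congr_left e.symm).congr_right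
    (B := charMod U) (CharacterModule.congr e'.symm)

/-- For M ≅ C ⊗ N, tensor a free cover of N with C; Tor_1(C, N) = 0 keeps it exact. -/
theorem IsWFGorenstein.exists_cover (h : IsWFGorenstein C M) :
    ∃ K V : ModuleCat.{u} R, IsCProjective C V ∧ IsWFGorenstein C K ∧ SES K V M := by
  obtain ⟨N, hN, ⟨e⟩⟩ := h.exists_tens hC
  obtain ⟨K, P, _, f, g, hs⟩ := exists_free_cover N
  exact ⟨tens C K, tens C P, ⟨P, inferInstance, ⟨.refl R _⟩⟩,
    (hN.syzygy ⟨f, g, hs⟩).isWFGorenstein hC (.refl R _),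
    SES.congr ⟨_, _, hs.lTensor (hN.torZero C (Or.inr rfl) 0)⟩ (.refl R _) (.refl R _) e.symm⟩

theorem IsWFGorenstein.exists_envelope (h : IsWFGorenstein C M) :
    ∃ W Y : ModuleCat.{u} R, IsCFlat C W ∧ IsWFGorenstein C Y ∧ SES M W Y := by
  obtain ⟨N, hN, ⟨e⟩⟩ := h.exists_tens hC
  obtain ⟨F, N', hF, hN', f, g, hs⟩ := hN.exists_coresolution
  exact ⟨tens C F, tens C N', ⟨F, inferInstance, ⟨.refl R _⟩⟩,
    hN'.isWFGorenstein hC (.refl R _),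
    SES.congr ⟨_, _, hs.lTensor (hN'.torZero C (Or.inr rfl) 0)⟩ e.symm (.refl R _) (.refl R _)⟩

/-- A module in `G(W_F)` is zero if its tensor products with all `C`-injective modules are. -/
theorem IsWFGorenstein.subsingleton (h : IsWFGorenstein C M)
    (hM : ∀ U : ModuleCat.{u} R, IsCInjective C U → ∀ φ : M →ₗ[R] charMod U, φ = 0) :
    Subsingleton M := by
  obtain ⟨N, hN, ⟨e⟩⟩ := h.exists_tens hC
  obtain ⟨F, N', hF, -, f, g, hs⟩ := hN.exists_coresolution
  have := injective_charMod F
  -- Test with the C-injective Hom(C, F⁺): maps from M to its character module correspond to maps N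
  -- → F⁺⁺. The composite N ↪ F ↪ F⁺⁺ must then vanish.
  obtain ⟨e'⟩ := hC.homMod_charMod_equiv (charMod F)
  have key (φ : N →ₗ[R] charMod (charMod F)) : φ = 0 := by
    have h0 := hM _ (isCInjective_homMod C (charMod F))
      (TensorProduct.lift (e'.symm.toLinearMap ∘ₗ φ).flip ∘ₗ e.toLinearMap)
    ext1 n
    refine e'.symm.injective (LinearMap.ext fun c => ?_)
    simpa using LinearMap.congr_fun h0 (e.symm (c ⊗ₜ n))
  have hN : Subsingleton N := subsingleton_of_forall_eq 0 fun n => hs.1 (by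
    rw [map_zero]
    refine CharacterModule.eq_zero_of_character_apply fun c => ?_
    exact DFunLike.congr_fun (LinearMap.congr_fun (key (charFlip LinearMap.id ∘ₗ f)) n) c)
  refine ⟨fun x y => e.injective ?_⟩
  have : Subsingleton (C ⊗[R] N) := subsingleton_of_forall_eq 0 fun x => by
    induction x with
    | zero => rfl
    | add x y hx hy => rw [hx, hy, add_zero]
    | tmul c n => rw [Subsingleton.elim n 0, TensorProduct.tmul_zero]
  exact Subsingleton.elim _ _

variable (hR : IsGFClosed R)

include hR

/-- Ext¹(C, A) = 0 makes Hom(C, -) exact here, so extension closure for relative Gorenstein flat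
modules applies; a five-lemma chase gives the counit at B. -/
theorem IsWFGorenstein.extension (h : SES A B D) (hA : IsWFGorenstein C A)
    (hD : IsWFGorenstein C D) : IsWFGorenstein C B := by
  obtain ⟨f, g, h⟩ := h
  have hA := hA.isFoxbyGorFlat hC
  have hD := hD.isFoxbyGorFlat hC
  have hh := h.hom (h.exists_lift (hA.extZero 0))
  have hB : IsGorFlat (TestClass C) (homMod C B) :=
    .extension (fun I hI => Or.inl hI) hR.extension ⟨_, _, hh⟩ hA.gorFlat hD.gorFlat
  have ht := hh.lTensor (hD.gorFlat.torZero C (Or.inr rfl) 0)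
  refine hB.isWFGorenstein hC (LinearEquiv.ofBijective (foxbyCounit C B) ?_).symm
  have h₁ : f ∘ₗ foxbyCounit C A = foxbyCounit C B ∘ₗ (f.compRight R).lTensor C :=
    LinearMap.ext fun x => (foxbyCounit_naturality f x).symm
  have h₂ : g ∘ₗ foxbyCounit C B = foxbyCounit C D ∘ₗ (g.compRight R).lTensor C :=
    LinearMap.ext fun x => (foxbyCounit_naturality g x).symm
  constructor
  · refine (injective_iff_map_eq_zero _).2 fun x hx => ?_
    obtain ⟨y, rfl⟩ := (ht.2.1 x).1 (hD.counit.1 (by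
      rw [map_zero, ← LinearMap.comp_apply, ← h₂, LinearMap.comp_apply, hx, map_zero]))
    rw [← LinearMap.comp_apply, ← h₁] at hx
    have := (injective_iff_map_eq_zero (f ∘ₗ foxbyCounit C A)).1 (h.1.comp hA.counit.1) y hx
    rw [this, map_zero]
  · intro b
    obtain ⟨d, hd⟩ := hD.counit.2 (g b)
    obtain ⟨x, rfl⟩ := ht.2.2 d
    rw [← LinearMap.comp_apply, ← h₂, LinearMap.comp_apply, ← sub_eq_zero, ← map_sub] at hd
    obtain ⟨a, ha⟩ := (h.2.1 _).1 hd
    obtain ⟨y, rfl⟩ := hA.counit.2 a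
    rw [← LinearMap.comp_apply, h₁, LinearMap.comp_apply] at ha
    exact ⟨x - (f.compRight R).lTensor C y, by rw [map_sub, ha, sub_sub_cancel]⟩

theorem IsWFGorenstein.kernel (h : SES A B D) (hB : IsWFGorenstein C B)
    (hD : IsWFGorenstein C D) : IsWFGorenstein C A := by
  obtain ⟨f, g, h⟩ := h
  have hB := hB.isFoxbyGorFlat hC
  have hD := hD.isFoxbyGorFlat hC
  have hh := h.hom (hC.exists_lift hB.counit.2 hD.counit.1 h.2.2)
  have hA : IsGorFlat (TestClass C) (homMod C A) :=
    .kernel (fun I hI => Or.inl hI) hR.extension ⟨_, _, hh⟩ hB.gorFlat hD.gorFlat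
  have ht := hh.lTensor (hD.gorFlat.torZero C (Or.inr rfl) 0)
  refine hA.isWFGorenstein hC (LinearEquiv.ofBijective (foxbyCounit C A) ?_).symm
  refine LinearMap.bijective_of_bijective_of_injective_of_left_exact
    _ _ f g _ _ (foxbyCounit C D) ?_ ?_ ht.2.1 h.2.1 hB.counit hD.counit.1 ht.1 h.1
  · exact LinearMap.ext fun x => (foxbyCounit_naturality f x).symm
  · exact LinearMap.ext fun x => (foxbyCounit_naturality g x).symm

/-- Bijective counits at A and B force one at D and translate injectivity of A → B into Tor_1(C,
Hom(C, D)) = 0; the hypothesis then transfers to Tor_1(I, Hom(C, D)) = 0. -/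
theorem IsWFGorenstein.quotient (h : SES A B D) (hA : IsWFGorenstein C A)
    (hB : IsWFGorenstein C B)
    (hD : ∀ U : ModuleCat.{u} R, IsCInjective C U → ExtZero D (charMod U) 1) :
    IsWFGorenstein C D := by
  obtain ⟨f, g, h⟩ := h
  have hA := hA.isFoxbyGorFlat hC
  have hB := hB.isFoxbyGorFlat hC
  have hh := h.hom (h.exists_lift (hA.extZero 0))
  have hbij : Function.Bijective (foxbyCounit C D) := by
    refine LinearMap.bijective_of_surjective_of_bijective_of_right_exact
      _ _ f g (foxbyCounit C A) _ _ ?_ ?_ (lTensor_exact C hh.2.1 hh.2.2) h.2.1 hA.counit.2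
      hB.counit (LinearMap.lTensor_surjective C hh.2.2) h.2.2
    · exact LinearMap.ext fun x => (foxbyCounit_naturality f x).symm
    · exact LinearMap.ext fun x => (foxbyCounit_naturality g x).symm
  have htor (i : ℕ) : ExtZero (homMod C D) (charMod C) (i + 1) := by
    cases i with
    | zero =>
      refine hh.extZero_of_lTensor_injective (hB.gorFlat.torZero C (Or.inr rfl) 0) ?_
      intro x y hxy
      apply hA.counit.1
      apply h.1
      rw [← foxbyCounit_naturality, ← foxbyCounit_naturality]
      exact congrArg _ hxy
    | succ i =>
      exact hh.extZero_quot_left (hA.gorFlat.torZero C (Or.inr rfl) i)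
        (hB.gorFlat.torZero C (Or.inr rfl) _)
  refine IsGorFlat.isWFGorenstein hC (N := homMod C D) ?_
    (LinearEquiv.ofBijective (foxbyCounit C D) hbij).symm
  refine .quotient (fun I hI => Or.inl hI) hR.extension ⟨_, _, hh⟩ hA.gorFlat hB.gorFlat
    fun I hI => (hC.extZero_tens_charMod_iff htor I 0).1 ?_
  exact (hD _ (isCInjective_homMod C I)).congr_left (LinearEquiv.ofBijective _ hbij).symm

end

end Closure

/-! ### Finite resolutions by G(W_F) and how their terms can be exchanged. -/

section Resolutions

variable {R : Type u} [CommRing R] {C : ModuleCat.{u} R}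

/-- There is an exact sequence `0 → X n → ⋯ → X 0 → M → 0` with `X i` in the class `p i`. -/
def HasResP : (ℕ → ModuleCat.{u} R → Prop) → ℕ → ModuleCat.{u} R → Prop
  | p, 0, M => p 0 M
  | p, n + 1, M => ∃ K X : ModuleCat.{u} R, p 0 X ∧ HasResP (fun i => p (i + 1)) n K ∧ SES K X M

/-- There is an exact sequence `0 → X n → ⋯ → X 0 → M → 0` with every `X i` in `𝒳`. -/
abbrev HasRes (𝒳 : ModuleCat.{u} R → Prop) (n : ℕ) (M : ModuleCat.{u} R) : Prop :=
  HasResP (fun _ => 𝒳) n M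

/-- There is an exact sequence `0 → M → X 0 → ⋯ → X n → 0` with every `X i` in `𝒳`. -/
def HasCores (𝒳 : ModuleCat.{u} R → Prop) : ℕ → ModuleCat.{u} R → Prop
  | 0, M => 𝒳 M
  | n + 1, M => ∃ X L : ModuleCat.{u} R, 𝒳 X ∧ HasCores 𝒳 n L ∧ SES M X L

variable {A B D K G M N U V W : ModuleCat.{u} R} {n k : ℕ}

theorem HasResP.mono {p q : ℕ → ModuleCat.{u} R → Prop} (h : HasResP p n M)
    (hpq : ∀ i ≤ n, ∀ X, p i X → q i X) : HasResP q n M := by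
  induction n generalizing p q M with
  | zero => exact hpq 0 le_rfl _ h
  | succ n ih =>
    obtain ⟨K, X, hX, hK, hs⟩ := h
    exact ⟨K, X, hpq 0 (Nat.zero_le _) _ hX,
      ih hK fun i hi => hpq (i + 1) (Nat.succ_le_succ hi), hs⟩

theorem HasRes.succ {𝒳 : ModuleCat.{u} R → Prop} (h0 : ∀ X : ModuleCat.{u} R, Subsingleton X → 𝒳 X)
    (h : HasRes 𝒳 n M) : HasRes 𝒳 (n + 1) M := by
  induction n generalizing M with
  | zero =>
    exact ⟨ModuleCat.of R PUnit, M, h, h0 _ inferInstance, SES.of_equiv' inferInstance (.refl R _)⟩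
  | succ n ih =>
    obtain ⟨K, X, hX, hK, hs⟩ := h
    exact ⟨K, X, hX, ih hK, hs⟩

theorem HasRes.le {𝒳 : ModuleCat.{u} R → Prop} (h0 : ∀ X : ModuleCat.{u} R, Subsingleton X → 𝒳 X)
    (h : HasRes 𝒳 n M) (hk : n ≤ k) : HasRes 𝒳 k M := by
  induction hk with
  | refl => exact h
  | step _ ih => exact ih.succ h0

section

variable (hC : IsSemidualizing C)
include hC

theorem IsWFGorenstein.of_subsingleton (M : ModuleCat.{u} R) (h : Subsingleton M) :
    IsWFGorenstein C M :=
  (IsCFlat.of_subsingleton C M).isWFGorenstein hC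

theorem HasRes.extZero (h : HasRes (IsWFGorenstein C) n M) (i : ℕ) : ExtZero C M (i + 1) := by
  induction n generalizing M i with
  | zero => exact (IsWFGorenstein.isFoxbyGorFlat hC h).extZero i
  | succ n ih =>
    obtain ⟨K, X, hX, hK, f, g, hs⟩ := h
    exact hs.extZero_quot_right ((hX.isFoxbyGorFlat hC).extZero i) (ih hK (i + 1))

theorem HasRes.extZero_charMod (h : HasRes (IsWFGorenstein C) n M) (hU : IsCInjective C U)
    (j : ℕ) : ExtZero M (charMod U) (n + j + 1) := by
  induction n generalizing M with
  | zero => rw [Nat.zero_add]; exact IsWFGorenstein.extZero_charMod hC h hU j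
  | succ n ih =>
    obtain ⟨K, X, hX, hK, f, g, hs⟩ := h
    have := hs.extZero_quot_left (ih hK) (hX.extZero_charMod hC hU (n + j + 1))
    rwa [show n + 1 + j + 1 = n + j + 1 + 1 by omega]

variable (hR : IsGFClosed R)
include hR

theorem HasRes.extension_left (h : SES A B D) (hA : IsWFGorenstein C A)
    (hD : HasRes (IsWFGorenstein C) n D) : HasRes (IsWFGorenstein C) n B := by
  cases n with
  | zero => exact IsWFGorenstein.extension hC hR h hA hD
  | succ n =>
    obtain ⟨K, X, hX, hK, hs⟩ := hD
    obtain ⟨Z, h1, h2⟩ := h.pullback hs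
    exact ⟨K, Z, IsWFGorenstein.extension hC hR h1 hA hX, hK, h2⟩

theorem HasRes.kernel (h : SES A B D) (hB : HasRes (IsWFGorenstein C) n B)
    (hD : IsWFGorenstein C D) : HasRes (IsWFGorenstein C) n A := by
  cases n with
  | zero => exact IsWFGorenstein.kernel hC hR h hB hD
  | succ n =>
    obtain ⟨K, X, hX, hK, hs⟩ := hB
    obtain ⟨Z, h1, h2⟩ := hs.kernel h
    exact ⟨K, Z, IsWFGorenstein.kernel hC hR h1 hX hD, hK, h2⟩

omit hR in
-- The sequence splits because Ext¹(C, A) = 0 and V is C-projective.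
theorem SES.equiv_prod (h : SES A B V) (hA : HasRes (IsWFGorenstein C) n A)
    (hV : IsCProjective C V) : Nonempty ((A × V) ≃ₗ[R] B) := by
  obtain ⟨f, g, h⟩ := h
  obtain ⟨s, hs⟩ := hV.exists_lift (h.exists_lift (HasRes.extZero hC hA 0)) LinearMap.id
  have hs' : ∀ v, g (s v) = v := fun v => DFunLike.congr_fun hs v
  have hgf : ∀ a, g (f a) = 0 := fun a => h.2.1.apply_apply_eq_zero a
  refine ⟨LinearEquiv.ofBijective (f.coprod s) ⟨?_, fun b => ?_⟩⟩
  · rw [← LinearMap.ker_eq_bot, LinearMap.ker_eq_bot']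
    rintro ⟨a, v⟩ hav
    have hav : f a + s v = 0 := by simpa using hav
    have hv : v = 0 := by simpa [hgf, hs'] using congrArg g hav
    subst hv
    have : f a = f 0 := by simpa using hav
    rw [h.1 this]
    rfl
  · obtain ⟨a, ha⟩ := (h.2.1 (b - s (g b))).1 (by rw [map_sub, hs', sub_self])
    exact ⟨(a, g b), by simp [ha]⟩

theorem HasRes.extension_right (h : SES A B D) (hA : HasRes (IsWFGorenstein C) n A)
    (hD : IsWFGorenstein C D) : HasRes (IsWFGorenstein C) n B := by
  induction n generalizing A B D with
  | zero => exact IsWFGorenstein.extension hC hR h hA hD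
  | succ n ih =>
    -- Over a C-projective cover V of D the extension splits, so A × V maps onto B with kernel D1.
    -- Composing with X × V → A × V leaves a kernel that extends D1 by A1, to which induction
    -- applies.
    obtain ⟨D1, V, hV, hD1, hs⟩ := hD.exists_cover hC
    obtain ⟨Z, h1, h2⟩ := h.pullback hs
    obtain ⟨e⟩ := SES.equiv_prod hC h1 hA hV
    obtain ⟨A1, X, hX, hA1, f, g, hf, hfg, hg⟩ := hA
    have h3 : SES A1 (ModuleCat.of R (X × V)) (ModuleCat.of R (A × V)) := by
      refine ⟨LinearMap.inl R X V ∘ₗ f, g.prodMap LinearMap.id, ?_, ?_, ?_⟩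
      · exact LinearMap.inl_injective.comp hf
      · rintro ⟨x, v⟩
        constructor
        · intro hx
          obtain ⟨hx, hv⟩ : g x = 0 ∧ v = 0 := Prod.mk.inj hx
          obtain ⟨a, rfl⟩ := (hfg x).1 hx
          exact ⟨a, by rw [hv]; rfl⟩
        · rintro ⟨a, ha⟩
          obtain ⟨hx, hv⟩ : f a = x ∧ 0 = v := Prod.mk.inj ha
          subst hx hv
          exact Prod.ext (hfg.apply_apply_eq_zero a) rfl
      · exact hg.prodMap Function.surjective_id
    have h4 : SES A1 (ModuleCat.of R (X × V)) Z := h3.congr (.refl R _) (.refl R _) e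
    obtain ⟨Y, h5, h6⟩ := h4.kernel h2
    refine ⟨Y, _, ?_, ih h6 hA1 hD1, h5⟩
    refine IsWFGorenstein.extension (A := X) (D := V) hC hR
      ⟨LinearMap.inl R X V, LinearMap.snd R X V, LinearMap.inl_injective, ?_,
        LinearMap.snd_surjective⟩ hX (hV.isCFlat.isWFGorenstein hC)
    exact LinearMap.exact_iff.2 (LinearMap.range_inl R X V).symm

/-- Schanuel-type argument: the pullback Z of G and X over M is an extension of G by K' and has
kernel K over X. -/
theorem HasRes.syzygy (h : SES K G M) (hG : IsWFGorenstein C G)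
    (hM : HasRes (IsWFGorenstein C) (n + 1) M) : HasRes (IsWFGorenstein C) n K := by
  obtain ⟨K', X, hX, hK', hs⟩ := hM
  obtain ⟨Z, h1, h2⟩ := h.pullback hs
  exact HasRes.kernel hC hR h1 (HasRes.extension_right hC hR h2 hK' hG) hX

/-- The first step of a resolution can be taken to be `C`-projective. -/
theorem HasRes.exists_cover (hM : HasRes (IsWFGorenstein C) (n + 1) M) :
    ∃ K V : ModuleCat.{u} R, IsCProjective C V ∧ HasRes (IsWFGorenstein C) n K ∧ SES K V M := by
  obtain ⟨K, G, hG, hK, hs⟩ := hM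
  obtain ⟨G1, V, hV, hG1, hs'⟩ := hG.exists_cover hC
  obtain ⟨Z, h1, h2⟩ := hs'.kernel hs
  exact ⟨Z, V, hV, HasRes.extension_left hC hR h2 hG1 hK, h1⟩

/-- The `C`-flat dimension is at most `n - 1`. -/
def HasResPred (C : ModuleCat.{u} R) : ℕ → ModuleCat.{u} R → Prop
  | 0, K => Subsingleton K
  | n + 1, K => HasRes (IsCFlat C) n K

omit hR in
-- Embed G in a C-flat W and take K' = W/K; its submodule G/K is M, with quotient W/G in G(W_F).
theorem HasResPred.exists_envelope (h : SES K G M) (hG : IsWFGorenstein C G)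
    (hK : HasResPred C n K) :
    ∃ K' G', IsWFGorenstein C G' ∧ HasRes (IsCFlat C) n K' ∧ SES M K' G' := by
  obtain ⟨W, G', hW, hG', hs⟩ := hG.exists_envelope hC
  obtain ⟨Q, h1, h2⟩ := h.quotient hs
  refine ⟨Q, G', hG', ?_, h2⟩
  cases n with
  | zero =>
    have : Subsingleton K := hK
    obtain ⟨f, g, h1⟩ := h1
    obtain ⟨e⟩ := h1.equiv_of_subsingleton_left
    exact IsCFlat.congr e hW
  | succ n => exact ⟨K, W, hW, hK, h1⟩

/-- By induction the kernel of G → M has a precover, hence an embedding into some K' of finite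
C-flat dimension. Pushing out along it enlarges G by an object of G(W_F) and replaces the kernel by
K'. -/
theorem HasRes.exists_precover (h : HasRes (IsWFGorenstein C) n M) :
    ∃ K G, IsWFGorenstein C G ∧ HasResPred C n K ∧ SES K G M := by
  induction n generalizing M with
  | zero =>
    exact ⟨ModuleCat.of R PUnit, M, h, inferInstanceAs (Subsingleton PUnit),
      SES.of_equiv' inferInstance (.refl R _)⟩
  | succ n ih =>
    obtain ⟨K, G, hG, hK, hs⟩ := h
    obtain ⟨L, H, hH, hL, hs'⟩ := ih hK
    obtain ⟨K', G', hG', hK', hs''⟩ := HasResPred.exists_envelope hC hs' hH hL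
    obtain ⟨Z, h1, h2⟩ := hs.pushout hs''
    exact ⟨K', Z, IsWFGorenstein.extension hC hR h1 hG hG', hK', h2⟩

theorem HasRes.exists_precover_of_envelope (h : SES M K G) (hK : HasRes (IsCFlat C) n K)
    (hG : IsWFGorenstein C G) : ∃ K G, IsWFGorenstein C G ∧ HasResPred C n K ∧ SES K G M := by
  cases n with
  | zero =>
    exact ⟨ModuleCat.of R PUnit, M,
      IsWFGorenstein.kernel hC hR h (IsCFlat.isWFGorenstein hC hK) hG,
      inferInstanceAs (Subsingleton PUnit), SES.of_equiv' inferInstance (.refl R _)⟩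
  | succ n =>
    obtain ⟨L, W, hW, hL, hs⟩ := hK
    obtain ⟨Z, h1, h2⟩ := hs.kernel h
    exact ⟨L, Z, IsWFGorenstein.kernel hC hR h1 (hW.isWFGorenstein hC) hG, hL, h2⟩

omit hR in
theorem HasResPred.hasRes (h : SES K G M) (hG : IsWFGorenstein C G)
    (hK : HasResPred C n K) : HasRes (IsWFGorenstein C) n M := by
  cases n with
  | zero =>
    have : Subsingleton K := hK
    obtain ⟨f, g, h⟩ := h
    obtain ⟨e⟩ := h.equiv_of_subsingleton_left
    exact IsWFGorenstein.congr e hG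
  | succ n =>
    exact ⟨K, G, hG, HasResP.mono hK fun _ _ _ hX => hX.isWFGorenstein hC, h⟩

/-- A resolution with a module from `G(W_F)` in degree `t` and `C`-flat modules elsewhere. -/
theorem HasRes.exists_at (h : HasRes (IsWFGorenstein C) n M) {t : ℕ} (ht : t ≤ n) :
    HasResP (fun i X => (i = t → IsWFGorenstein C X) ∧ (i ≠ t → IsCFlat C X)) n M := by
  induction n generalizing M t with
  | zero =>
    obtain rfl : t = 0 := by omega
    exact ⟨fun _ => h, fun h => absurd rfl h⟩
  | succ n ih =>
    cases t with
    | zero =>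
      obtain ⟨K, G, hG, hK, hs⟩ := HasRes.exists_precover hC hR h
      exact ⟨K, G, ⟨fun _ => hG, fun h => absurd rfl h⟩,
        HasResP.mono hK fun i _ X hX => ⟨fun h => by omega, fun _ => hX⟩, hs⟩
    | succ t =>
      obtain ⟨K, V, hV, hK, hs⟩ := HasRes.exists_cover hC hR h
      refine ⟨K, V, ⟨fun h => by omega, fun _ => hV.isCFlat⟩,
        HasResP.mono (ih hK (Nat.le_of_succ_le_succ ht)) fun i _ X hX => ?_, hs⟩
      exact ⟨fun h => hX.1 (by omega), fun h => hX.2 (by omega)⟩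

theorem HasRes.exists_cProjective (h : HasRes (IsWFGorenstein C) n M) :
    HasResP (fun i X => (i = n → IsWFGorenstein C X) ∧ (i < n → IsCProjective C X)) n M := by
  induction n generalizing M with
  | zero => exact ⟨fun _ => h, fun h => by omega⟩
  | succ n ih =>
    obtain ⟨K, V, hV, hK, hs⟩ := HasRes.exists_cover hC hR h
    exact ⟨K, V, ⟨fun h => by omega, fun _ => hV⟩, HasResP.mono (ih hK) fun i _ X hX =>
      ⟨fun h => hX.1 (by omega), fun h => hX.2 (by omega)⟩, hs⟩

/-- Finite dimension is detected by `Tor`. -/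
theorem HasRes.isWFGorenstein (h : HasRes (IsWFGorenstein C) n M)
    (hM : ∀ U : ModuleCat.{u} R, IsCInjective C U → ∀ j, ExtZero M (charMod U) (j + 1)) :
    IsWFGorenstein C M := by
  induction n generalizing M with
  | zero => exact h
  | succ n ih =>
    obtain ⟨K, G, hG, hK, hs⟩ := h
    -- The kernel inherits Tor-vanishing and has a shorter resolution, so it lies in G(W_F); then M
    -- is a quotient of the admissible kind.
    refine IsWFGorenstein.quotient hC hR hs (ih hK fun U hU j => ?_) hG fun U hU => hM U hU 0
    obtain ⟨f, g, hs⟩ := hs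
    exact hs.extZero_sub_left (hG.extZero_charMod hC hU j) (hM U hU (j + 1))

theorem HasRes.of_extZero (h : HasRes (IsWFGorenstein C) k M)
    (hM : ∀ U : ModuleCat.{u} R, IsCInjective C U → ∀ j, ExtZero M (charMod U) (n + j + 1)) :
    HasRes (IsWFGorenstein C) n M := by
  induction n generalizing M k with
  | zero =>
    exact HasRes.isWFGorenstein hC hR h fun U hU j => by simpa using hM U hU j
  | succ n ih =>
    -- Padding by zero guarantees that a first step can be removed even when k = 0.
    obtain ⟨K, G, hG, hK, hs⟩ := h.succ (IsWFGorenstein.of_subsingleton hC)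
    refine ⟨K, G, hG, ih hK fun U hU j => ?_, hs⟩
    obtain ⟨f, g, hs⟩ := hs
    refine hs.extZero_sub_left (hG.extZero_charMod hC hU (n + j)) ?_
    have := hM U hU j
    rwa [show n + 1 + j + 1 = n + j + 1 + 1 by omega] at this

end

theorem HasRes.truncate {𝒳 : ModuleCat.{u} R → Prop} (h : HasRes 𝒳 (n + k) M) :
    HasResP (fun i X => i < n → 𝒳 X) n M := by
  induction n generalizing M with
  | zero => exact fun h => by omega
  | succ n ih =>
    rw [show n + 1 + k = n + k + 1 by omega] at h
    obtain ⟨K, G, hG, hK, hs⟩ := h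
    exact ⟨K, G, fun _ => hG, HasResP.mono (ih hK) fun i _ X hX h => hX (by omega), hs⟩

/-- Dualizing 0 → U → X → L → 0 places Ext^i(M, U⁺) between Ext^i(M, X⁺) and Ext^{i+1}(M, L⁺). -/
theorem HasCores.extZero_charMod (hU : HasCores (IsCInjective C) k U)
    (hM : ∀ U : ModuleCat.{u} R, IsCInjective C U → ∀ j, ExtZero M (charMod U) (n + j + 1))
    (j : ℕ) : ExtZero M (charMod U) (n + j + 1) := by
  induction k generalizing U j with
  | zero => exact hM U hU j
  | succ k ih =>
    obtain ⟨X, L, hX, hL, f, g, hs⟩ := hU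
    exact hs.dual.extZero_quot_right (hM X hX j) (ih hL (j + 1))

end Resolutions

/-! ### From dimensions defined as infima to the existence of finite resolutions. -/

section Bridge

variable {R : Type u} [CommRing R] {K M N X : ModuleCat.{u} R} {n : ℕ}

/-- The resolution `⋯ → 0 → 0 → M → M → 0`. -/
def LeftSeq.single (M : ModuleCat.{u} R) : LeftSeq M where
  X := fun
    | 0 => M
    | _ + 1 => ModuleCat.of R PUnit
  d := fun _ => 0
  aug := LinearMap.id
  exact_d := fun _ _ => ⟨fun _ => ⟨0, Subsingleton.elim (α := PUnit) _ _⟩, fun _ => rfl⟩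
  exact_aug := fun _ => ⟨fun h => ⟨0, Eq.symm h⟩, fun ⟨_, h⟩ => Eq.symm h⟩
  surjective_aug := Function.surjective_id

/-- Splice a resolution of `K` with a short exact sequence `0 → K → X → M → 0`. -/
def LeftSeq.cons (P : LeftSeq K) {f : K →ₗ[R] X} {g : X →ₗ[R] M} (h : IsShortExact f g) :
    LeftSeq M where
  X := fun
    | 0 => X
    | n + 1 => P.X n
  d := fun
    | 0 => f ∘ₗ P.aug
    | n + 1 => P.d n
  aug := g
  exact_d := fun
    | 0 => fun x => by
      change f (P.aug x) = 0 ↔ _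
      rw [← P.exact_aug x, map_eq_zero_iff f h.1]
    | n + 1 => P.exact_d n
  exact_aug := fun x => by
    rw [h.2.1 x]
    exact ⟨fun ⟨k, hk⟩ => let ⟨y, hy⟩ := P.surjective_aug k; ⟨y, by rw [← hk, ← hy]; rfl⟩,
      fun ⟨y, hy⟩ => ⟨P.aug y, hy⟩⟩
  surjective_aug := h.2.2

/-- The resolution of the first syzygy. -/
def LeftSeq.tail (P : LeftSeq M) : LeftSeq (ModuleCat.of R (LinearMap.ker P.aug)) where
  X := fun n => P.X (n + 1)
  d := fun n => P.d (n + 1)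
  aug := (P.d 0).codRestrict _ fun x => P.exact_aug.apply_apply_eq_zero x
  exact_d := fun n => P.exact_d (n + 1)
  exact_aug := fun x => by
    rw [← P.exact_d 0 x]
    exact ⟨fun h => congrArg Subtype.val h, fun h => Subtype.ext h⟩
  surjective_aug := fun ⟨x, hx⟩ => by
    obtain ⟨y, hy⟩ := (P.exact_aug x).1 hx
    exact ⟨y, Subtype.ext hy⟩

theorem LeftSeq.ses (P : LeftSeq M) : SES (ModuleCat.of R (LinearMap.ker P.aug)) (P.X 0) M :=
  ⟨_, _, isShortExact_ker P.aug P.surjective_aug⟩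

theorem LeftSeq.nonempty_equiv (P : LeftSeq M) (h : Subsingleton (P.X 1)) :
    Nonempty (P.X 0 ≃ₗ[R] M) :=
  ⟨LinearEquiv.ofBijective P.aug ⟨(injective_iff_map_eq_zero _).2 fun x hx => by
    obtain ⟨y, rfl⟩ := (P.exact_aug x).1 hx
    rw [Subsingleton.elim y 0, map_zero], P.surjective_aug⟩⟩

theorem HasResP.exists_leftSeq {p : ℕ → ModuleCat.{u} R → Prop} (h : HasResP p n M) :
    ∃ P : LeftSeq M, (∀ i, n < i → Subsingleton (P.X i)) ∧ ∀ i ≤ n, p i (P.X i) := by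
  induction n generalizing p M with
  | zero =>
    refine ⟨LeftSeq.single M, fun i hi => ?_, fun i hi => ?_⟩
    · obtain ⟨i, rfl⟩ := Nat.exists_eq_succ_of_ne_zero hi.ne'
      exact inferInstanceAs (Subsingleton PUnit)
    · obtain rfl : i = 0 := by omega
      exact h
  | succ n ih =>
    obtain ⟨K, X, hX, hK, f, g, hs⟩ := h
    obtain ⟨P, h0, hP⟩ := ih hK
    refine ⟨P.cons hs, fun i hi => ?_, fun i hi => ?_⟩
    · obtain ⟨i, rfl⟩ := Nat.exists_eq_succ_of_ne_zero (Nat.ne_of_gt (Nat.zero_lt_of_lt hi))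
      exact h0 i (Nat.lt_of_succ_lt_succ hi)
    · cases i with
      | zero => exact hX
      | succ i => exact hP i (Nat.le_of_succ_le_succ hi)

theorem LeftSeq.hasResP {p : ℕ → ModuleCat.{u} R → Prop} (P : LeftSeq M)
    (hp : ∀ i (X Y : ModuleCat.{u} R), (X ≃ₗ[R] Y) → p i X → p i Y)
    (h0 : ∀ i, n < i → Subsingleton (P.X i)) (hP : ∀ i ≤ n, p i (P.X i)) : HasResP p n M := by
  induction n generalizing p M with
  | zero =>
    obtain ⟨e⟩ := P.nonempty_equiv (h0 1 one_pos)
    exact hp 0 _ _ e (hP 0 le_rfl)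
  | succ n ih =>
    exact ⟨_, P.X 0, hP 0 (Nat.zero_le _), ih P.tail (fun i => hp (i + 1))
      (fun i hi => h0 (i + 1) (Nat.succ_lt_succ hi)) (fun i hi => hP (i + 1) (Nat.succ_le_succ hi)),
      P.ses⟩

/-- A strict bound on an infimum is witnessed by one member of the family; rewriting ≤ n as < n + 1
thus extracts an actual resolution. -/
theorem WithBot.enat_le_iff_lt {x : WithBot ℕ∞} {n : ℕ} :
    x ≤ n ↔ x < ((n + 1 : ℕ) : WithBot ℕ∞) := by
  induction x with
  | bot => simp
  | coe x =>
    change ((x : WithBot ℕ∞) ≤ ((n : ℕ∞) : WithBot ℕ∞)) ↔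
      (x : WithBot ℕ∞) < (((n + 1 : ℕ) : ℕ∞) : WithBot ℕ∞)
    rw [WithBot.coe_le_coe, WithBot.coe_lt_coe]
    push_cast
    exact (ENat.lt_add_one_iff (ENat.natCast_ne_top n)).symm

theorem WithBot.enat_lt_top_iff {x : WithBot ℕ∞} : x < ⊤ ↔ ∃ n : ℕ, x ≤ n := by
  constructor
  · induction x with
    | bot => exact fun _ => ⟨0, bot_le⟩
    | coe x =>
      intro h
      have hx : x ≠ ⊤ := fun hx => by subst hx; exact lt_irrefl _ h
      lift x to ℕ using hx
      exact ⟨x, le_rfl⟩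
  · rintro ⟨n, hn⟩
    exact (WithBot.enat_le_iff_lt.1 hn).trans_le le_top

theorem sSup_support_le_iff {Y : ℕ → ModuleCat.{u} R} :
    sSup {m : WithBot ℕ∞ | ∃ i : ℕ, Nontrivial (Y i) ∧ m = i} ≤ n ↔
      ∀ i, n < i → Subsingleton (Y i) := by
  rw [sSup_le_iff]
  constructor
  · intro h i hi
    by_contra hY
    have := h i ⟨i, not_subsingleton_iff_nontrivial.1 hY, rfl⟩
    exact hi.not_ge (by exact_mod_cast this)
  · rintro h _ ⟨i, hi, rfl⟩
    by_contra hlt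
    refine not_subsingleton_iff_nontrivial.2 hi (h i ?_)
    by_contra hni
    exact hlt (by exact_mod_cast not_lt.1 hni)

variable {𝒳 : ModuleCat.{u} R → Prop}

theorem projDim_le_iff_exists :
    projDim 𝒳 M ≤ n ↔ ∃ P : LeftSeq M, (∀ i, 𝒳 (P.X i)) ∧ ∀ i, n < i → Subsingleton (P.X i) := by
  rw [WithBot.enat_le_iff_lt, projDim, iInf_lt_iff]
  simp only [← WithBot.enat_le_iff_lt, sSup_support_le_iff]
  exact ⟨fun ⟨P, hP⟩ => ⟨P.1, P.2, hP⟩, fun ⟨P, h, hP⟩ => ⟨⟨P, h⟩, hP⟩⟩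

theorem projDim_le_iff (h0 : ∀ X : ModuleCat.{u} R, Subsingleton X → 𝒳 X)
    (he : ∀ X Y : ModuleCat.{u} R, (X ≃ₗ[R] Y) → 𝒳 X → 𝒳 Y) :
    projDim 𝒳 M ≤ n ↔ HasRes 𝒳 n M := by
  rw [projDim_le_iff_exists]
  constructor
  · rintro ⟨P, hP, hn⟩
    exact P.hasResP (fun _ => he) hn fun i _ => hP i
  · intro h
    obtain ⟨P, hn, hP⟩ := h.exists_leftSeq
    refine ⟨P, fun i => ?_, hn⟩
    rcases le_or_gt i n with hi | hi
    · exact hP i hi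
    · exact h0 _ (hn i hi)

theorem projDim_eq_bot_iff (h0 : ∀ X : ModuleCat.{u} R, Subsingleton X → 𝒳 X) :
    projDim 𝒳 M = ⊥ ↔ Subsingleton M := by
  constructor
  · intro h
    have : projDim 𝒳 M < ((0 : ℕ) : WithBot ℕ∞) := h ▸ WithBot.bot_lt_coe _
    rw [projDim, iInf_lt_iff] at this
    obtain ⟨P, hP⟩ := this
    have : Subsingleton (P.1.X 0) := by
      by_contra hX
      exact hP.not_ge (le_sSup ⟨0, not_subsingleton_iff_nontrivial.1 hX, rfl⟩)
    exact P.1.surjective_aug.subsingleton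
  · intro h
    have hX : ∀ i, Subsingleton ((LeftSeq.single M).X i) := fun
      | 0 => h
      | _ + 1 => inferInstanceAs (Subsingleton PUnit)
    refine le_bot_iff.1 ((iInf_le _ ⟨LeftSeq.single M, fun i => h0 _ (hX i)⟩).trans ?_)
    refine sSup_le ?_
    rintro _ ⟨i, hi, -⟩
    exact absurd (hX i) (not_subsingleton_iff_nontrivial.2 hi)

/-- The right resolution of the first cosyzygy. -/
def RightSeq.tail (P : RightSeq M) : RightSeq (ModuleCat.of R (LinearMap.range (P.d 0))) where
  X := fun n => P.X (n + 1)
  d := fun n => P.d (n + 1)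
  aug := (LinearMap.range (P.d 0)).subtype
  injective_aug := Subtype.val_injective
  exact_aug := fun x => by
    rw [P.exact_d 0 x]
    exact ⟨fun h => ⟨⟨x, h⟩, rfl⟩, fun ⟨y, hy⟩ => hy ▸ y.2⟩
  exact_d := fun n => P.exact_d (n + 1)

theorem RightSeq.hasCores (P : RightSeq M)
    (he : ∀ X Y : ModuleCat.{u} R, (X ≃ₗ[R] Y) → 𝒳 X → 𝒳 Y)
    (h0 : ∀ i, n < i → Subsingleton (P.X i)) (hP : ∀ i, 𝒳 (P.X i)) : HasCores 𝒳 n M := by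
  induction n generalizing M with
  | zero =>
    refine he _ _ (LinearEquiv.ofBijective P.aug ⟨P.injective_aug, fun x => ?_⟩).symm (hP 0)
    have := h0 1 one_pos
    exact (P.exact_aug x).1 (Subsingleton.elim _ _)
  | succ n ih =>
    refine ⟨P.X 0, _, hP 0, ih P.tail (fun i hi => h0 (i + 1) (Nat.succ_lt_succ hi))
      (fun i => hP (i + 1)), P.aug, (P.d 0).rangeRestrict, P.injective_aug, fun x => ?_,
      (P.d 0).surjective_rangeRestrict⟩
    rw [← P.exact_aug x]
    exact ⟨fun h => congrArg Subtype.val h, fun h => Subtype.ext h⟩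

theorem exists_hasCores (he : ∀ X Y : ModuleCat.{u} R, (X ≃ₗ[R] Y) → 𝒳 X → 𝒳 Y)
    (h : injDim 𝒳 M < ⊤) : ∃ n, HasCores 𝒳 n M := by
  obtain ⟨n, hn⟩ := WithBot.enat_lt_top_iff.1 h
  rw [WithBot.enat_le_iff_lt, injDim, iInf_lt_iff] at hn
  simp only [← WithBot.enat_le_iff_lt, sSup_support_le_iff] at hn
  obtain ⟨P, hP⟩ := hn
  exact ⟨n, P.1.hasCores he hP P.2⟩

/-- The resolution `0 → M → M → 0 → 0 → ⋯`. -/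
def RightSeq.single (M : ModuleCat.{u} R) : RightSeq M where
  X := fun
    | 0 => M
    | _ + 1 => ModuleCat.of R PUnit
  d := fun _ => 0
  aug := LinearMap.id
  injective_aug := Function.injective_id
  exact_aug := fun x => ⟨fun _ => ⟨x, rfl⟩, fun _ => rfl⟩
  exact_d := fun _ _ => ⟨fun _ => ⟨0, Subsingleton.elim (α := PUnit) _ _⟩, fun _ => rfl⟩

theorem injDim_lt_top (h0 : ∀ X : ModuleCat.{u} R, Subsingleton X → 𝒳 X) (h : 𝒳 M) :
    injDim 𝒳 M < ⊤ := by
  have h1 : ∀ i, Subsingleton ((RightSeq.single M).X (i + 1)) :=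
    fun i => inferInstanceAs (Subsingleton PUnit)
  have hX : ∀ i, 𝒳 ((RightSeq.single M).X i) := fun
    | 0 => h
    | i + 1 => h0 _ (h1 i)
  refine WithBot.enat_lt_top_iff.2 ⟨0, (iInf_le _ ⟨RightSeq.single M, hX⟩).trans ?_⟩
  refine sSup_support_le_iff.2 fun i hi => ?_
  obtain ⟨i, rfl⟩ := Nat.exists_eq_succ_of_ne_zero hi.ne'
  exact h1 i

variable {C U V : ModuleCat.{u} R}

theorem IsCInjective.congr (e : U ≃ₗ[R] V) (h : IsCInjective C U) : IsCInjective C V := by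
  obtain ⟨I, hI, ⟨e'⟩⟩ := h
  exact ⟨I, hI, ⟨e.symm ≪≫ₗ e'⟩⟩

theorem IsCInjective.of_subsingleton (C M : ModuleCat.{u} R) (h : Subsingleton M) :
    IsCInjective C M := by
  refine ⟨ModuleCat.of R PUnit, ⟨fun _ _ _ _ _ _ _ _ _ => ⟨0, fun _ =>
    Subsingleton.elim (α := PUnit) _ _⟩⟩, ⟨?_⟩⟩
  have : Subsingleton (C →ₗ[R] ModuleCat.of R PUnit.{u + 1}) :=
    ⟨fun f g => LinearMap.ext fun x => Subsingleton.elim (α := PUnit) _ _⟩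
  exact { (0 : M →ₗ[R] (C →ₗ[R] ModuleCat.of R PUnit.{u + 1})) with
    invFun := fun _ => 0
    left_inv := fun _ => Subsingleton.elim _ _
    right_inv := fun _ => Subsingleton.elim _ _ }

/-- As ⊥ + 1 = ⊥, the bound at n = 0 holds exactly for K = 0, which is the convention for dimension
≤ -1. -/
theorem projDim_add_one_le_iff {K : ModuleCat.{u} R} :
    projDim (IsCFlat C) K + 1 ≤ (n : WithBot ℕ∞) ↔ HasResPred C n K := by
  cases n with
  | zero =>
    change _ ↔ Subsingleton K
    rw [← projDim_eq_bot_iff (𝒳 := IsCFlat C) fun X _ => IsCFlat.of_subsingleton C X]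
    generalize projDim (IsCFlat C) K = x
    induction x with
    | bot => simp
    | coe x =>
      simp only [WithBot.coe_ne_bot, iff_false, not_le]
      change ((0 : ℕ∞) : WithBot ℕ∞) < ((x + 1 : ℕ∞) : WithBot ℕ∞)
      rw [WithBot.coe_lt_coe]
      exact lt_of_lt_of_le one_pos le_add_self
  | succ n =>
    change _ ↔ HasRes (IsCFlat C) n K
    rw [← projDim_le_iff (fun X _ => IsCFlat.of_subsingleton C X) fun _ _ e h => h.congr e]
    generalize projDim (IsCFlat C) K = x
    induction x with
    | bot => simp
    | coe x =>
      change ((x + 1 : ℕ∞) : WithBot ℕ∞) ≤ (((n + 1 : ℕ) : ℕ∞) : WithBot ℕ∞) ↔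
        (x : WithBot ℕ∞) ≤ ((n : ℕ∞) : WithBot ℕ∞)
      rw [WithBot.coe_le_coe, WithBot.coe_le_coe]
      push_cast
      exact ENat.add_le_add_iff_right ENat.one_ne_top

end Bridge

/-! ### Comparison of Tor with Ext into character modules. -/

section Tor

variable {R : Type u} [CommRing R]

/-- The character of `U ⊗ M` given by a map from `M` to the character module of `U`. -/
noncomputable def tensChar {U M : ModuleCat.{u} R} (f : M →ₗ[R] charMod U) :
    CharacterModule (U ⊗[R] M) :=
  CharacterModule.homEquiv (charFlip f)

theorem tensChar_surjective {U M : ModuleCat.{u} R} :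
    Function.Surjective (tensChar : (M →ₗ[R] charMod U) → CharacterModule (U ⊗[R] M)) := by
  intro φ
  obtain ⟨f, rfl⟩ := CharacterModule.homEquiv.surjective φ
  exact ⟨charFlip f, rfl⟩

theorem tensChar_comp {U M N : ModuleCat.{u} R} (f : M →ₗ[R] charMod U) (d : N →ₗ[R] M)
    (x : U ⊗[R] N) : tensChar (f ∘ₗ d) x = tensChar f (d.lTensor U x) := by
  induction x with
  | zero => simp
  | tmul u n => rfl
  | add x y hx hy => simp only [map_add, hx, hy]

theorem tensChar_injective {U M : ModuleCat.{u} R} :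
    Function.Injective (tensChar : (M →ₗ[R] charMod U) → CharacterModule (U ⊗[R] M)) :=
  fun _ _ h => LinearMap.ext fun m => DFunLike.ext _ _ fun u => DFunLike.congr_fun h (u ⊗ₜ[R] m)

/-- A complex of abelian groups is exact if and only if its dual is. -/
theorem exact_iff_character {A B D : Type*} [AddCommGroup A] [AddCommGroup B] [AddCommGroup D]
    (f : A →ₗ[ℤ] B) (g : B →ₗ[ℤ] D) (hgf : g ∘ₗ f = 0) :
    Function.Exact f g ↔ ∀ φ : CharacterModule B, (∀ a, φ (f a) = 0) →
      ∃ ψ : CharacterModule D, ∀ b, ψ (g b) = φ b := by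
  constructor
  · intro h φ hφ
    obtain ⟨t, ht⟩ := exists_factor_of_surjective g.rangeRestrict g.surjective_rangeRestrict
      (AddMonoidHom.toIntLinearMap φ) (fun x hx => by
        obtain ⟨a, rfl⟩ := (h x).1 (congrArg Subtype.val hx)
        exact hφ a)
    obtain ⟨ψ, hψ⟩ := CharacterModule.dual_surjective_of_injective (LinearMap.range g).subtype
      Subtype.val_injective t.toAddMonoidHom
    refine ⟨ψ, fun b => ?_⟩
    rw [← show t (g.rangeRestrict b) = φ b from ht b]
    exact DFunLike.congr_fun hψ (g.rangeRestrict b)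
  · intro h b
    constructor
    · intro hb
      by_contra hn
      have hn : (LinearMap.range f).mkQ b ≠ 0 := by
        rwa [ne_eq, Submodule.mkQ_apply, Submodule.Quotient.mk_eq_zero]
      obtain ⟨c, hc⟩ := CharacterModule.exists_character_apply_ne_zero_of_ne_zero hn
      obtain ⟨ψ, hψ⟩ := h (CharacterModule.dual (LinearMap.range f).mkQ c) fun a => by
        change c ((LinearMap.range f).mkQ (f a)) = 0
        rw [(Submodule.Quotient.mk_eq_zero _).2 (LinearMap.mem_range_self f a) |>
          (Submodule.mkQ_apply _ _).trans, map_zero]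
      refine hc ((hψ b).symm.trans ?_)
      rw [hb, map_zero]
    · rintro ⟨a, rfl⟩
      exact LinearMap.congr_fun hgf a

/-- Characters of U ⊗ M are maps M → U⁺, and characters detect exactness of a complex. -/
theorem exact_lTensor_iff {A B D : ModuleCat.{u} R} (U : ModuleCat.{u} R) (f : A →ₗ[R] B)
    (g : B →ₗ[R] D) (hgf : g ∘ₗ f = 0) :
    Function.Exact (f.lTensor U) (g.lTensor U) ↔ ∀ φ : B →ₗ[R] charMod U, φ ∘ₗ f = 0 →
      ∃ ψ : D →ₗ[R] charMod U, ψ ∘ₗ g = φ := by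
  have h0 : g.lTensor U ∘ₗ f.lTensor U = 0 := by
    rw [← LinearMap.lTensor_comp, hgf, LinearMap.lTensor_zero]
  refine (exact_iff_character (f.lTensor U).toAddMonoidHom.toIntLinearMap
    (g.lTensor U).toAddMonoidHom.toIntLinearMap
    (LinearMap.ext fun x => LinearMap.congr_fun h0 x)).trans ?_
  rw [tensChar_surjective.forall]
  refine forall_congr' fun φ => imp_congr ?_ ?_
  · constructor
    · intro h
      refine tensChar_injective (DFunLike.ext _ _ fun x => ?_)
      rw [tensChar_comp]
      refine (h x).trans ?_
      induction x with
      | zero => simp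
      | tmul u n => rfl
      | add x y hx hy => rw [map_add, ← hx, ← hy, add_zero]
    · intro h a
      refine (tensChar_comp φ f a).symm.trans ?_
      rw [h]
      induction a with
      | zero => simp
      | tmul u n => rfl
      | add x y hx hy => rw [map_add, hx, hy, add_zero]
  · rw [tensChar_surjective.exists]
    refine exists_congr fun ψ => ⟨fun h => ?_, fun h b => ?_⟩
    · refine tensChar_injective (DFunLike.ext _ _ fun x => ?_)
      rw [tensChar_comp]
      exact h x
    · rw [← h, tensChar_comp]
      rfl

theorem extZero_succ_iff {X Y : ModuleCat.{u} R} (P : ProjectiveResolution X) (n : ℕ) :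
    ExtZero X Y (n + 1) ↔ ∀ φ : P.complex.X (n + 1) ⟶ Y, P.complex.d (n + 2) (n + 1) ≫ φ = 0 →
      ∃ ψ : P.complex.X n ⟶ Y, P.complex.d (n + 1) n ≫ ψ = φ := by
  constructor
  · intro h φ hφ
    exact (P.extMk_eq_zero_iff φ (n + 2) rfl hφ n rfl).1 (h.elim _ _)
  · intro h
    refine subsingleton_of_forall_eq 0 fun x => ?_
    obtain ⟨φ, hφ, rfl⟩ := P.extMk_surjective x (n + 2) rfl
    exact (P.extMk_eq_zero_iff φ (n + 2) rfl hφ n rfl).2 (h φ hφ)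

/-- Both sides are computed from the same projective resolution of M: tensoring with U is exact at a
spot precisely when its dual, Hom into U⁺, is. -/
theorem torVanishes_succ_iff {n : ℕ} {U M : ModuleCat.{u} R} :
    TorVanishes (n + 1) U M ↔ ExtZero M (charMod U) (n + 1) := by
  let P := projectiveResolution M
  let F := (MonoidalCategory.tensoringLeft (ModuleCat.{u} R)).obj U
  rw [extZero_succ_iff P]
  have h1 : TorVanishes (n + 1) U M ↔
      Limits.IsZero (((F.mapHomologicalComplex _).obj P.complex).homology (n + 1)) :=
    (P.isoLeftDerivedObj F (n + 1)).isZero_iff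
  rw [h1, ← HomologicalComplex.exactAt_iff_isZero_homology,
    HomologicalComplex.exactAt_iff' _ (n + 2) (n + 1) n (by simp) (by simp),
    ShortComplex.ShortExact.moduleCat_exact_iff_function_exact]
  refine (exact_lTensor_iff U (P.complex.d (n + 2) (n + 1)).hom (P.complex.d (n + 1) n).hom
    ?_).trans ?_
  · rw [← ModuleCat.hom_comp, P.complex.d_comp_d]; rfl
  · constructor
    · intro h φ hφ
      obtain ⟨ψ, hψ⟩ := h φ.hom (congrArg ModuleCat.Hom.hom hφ)
      exact ⟨ModuleCat.ofHom ψ, ModuleCat.hom_ext hψ⟩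
    · intro h φ hφ
      obtain ⟨ψ, hψ⟩ := h (ModuleCat.ofHom φ) (ModuleCat.hom_ext hφ)
      exact ⟨ψ.hom, congrArg ModuleCat.Hom.hom hψ⟩

theorem eq_zero_of_torVanishes_zero {U M : ModuleCat.{u} R} (h : TorVanishes 0 U M)
    (φ : M →ₗ[R] charMod U) : φ = 0 := by
  let F := (MonoidalCategory.tensorLeft U : ModuleCat.{u} R ⥤ ModuleCat.{u} R)
  have h1 : Limits.IsZero ((F.leftDerived 0).obj M) := h
  have h2 : Limits.IsZero (F.obj M) := h1.of_iso (F.leftDerivedZeroIsoSelf.app M).symm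
  have h3 : Subsingleton (U ⊗[R] M) := ModuleCat.subsingleton_of_isZero h2
  refine LinearMap.ext fun m => DFunLike.ext _ _ fun u => ?_
  change tensChar φ (u ⊗ₜ m) = 0
  rw [Subsingleton.elim (u ⊗ₜ[R] m) 0, map_zero]

theorem torVanishes_of_subsingleton {n : ℕ} {U M : ModuleCat.{u} R} (h : Subsingleton M) :
    TorVanishes n U M := by
  cases n with
  | zero =>
    let F := (MonoidalCategory.tensorLeft U : ModuleCat.{u} R ⥤ ModuleCat.{u} R)
    exact (F.map_isZero (ModuleCat.isZero_of_subsingleton M)).of_iso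
      (F.leftDerivedZeroIsoSelf.app M)
  | succ n =>
    have : Projective M := (ModuleCat.isZero_of_subsingleton M).projective
    exact isZero_Tor_succ_of_projective (ModuleCat.{u} R) U M n

end Tor

/-! ### The individual equivalences and the dimension formulas. -/

section Main

variable {R : Type u} [CommRing R] {C M : ModuleCat.{u} R} {n : ℕ}

/-- Bounds by natural numbers cannot distinguish ⊥ from 0, hence the extra hypothesis. -/
theorem WithBot.enat_eq_of_forall_le_iff {x y : WithBot ℕ∞} (h0 : x = ⊥ ↔ y = ⊥)
    (h : ∀ n : ℕ, x ≤ n ↔ y ≤ n) : x = y := by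
  induction x with
  | bot => exact (h0.1 rfl).symm
  | coe x =>
    induction y with
    | bot => exact h0.2 rfl
    | coe y =>
      congr 1
      refine ENat.eq_of_forall_natCast_le_iff fun n => ?_
      cases n with
      | zero => simp
      | succ n =>
        have h' : x ≤ n ↔ y ≤ n := by
          rw [← WithBot.coe_le_coe, ← WithBot.coe_le_coe (a := y)]
          exact h n
        rw [Nat.cast_succ, ENat.add_one_le_iff (ENat.natCast_ne_top n),
          ENat.add_one_le_iff (ENat.natCast_ne_top n), ← not_le, ← not_le, h']

theorem sSup_tor_le_iff {𝒰 : ModuleCat.{u} R → Prop} :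
    sSup {m : WithBot ℕ∞ | ∃ k : ℕ, (∃ U, 𝒰 U ∧ ¬ TorVanishes k U M) ∧ m = k} ≤ n ↔
      ∀ j, 1 ≤ j → ∀ U, 𝒰 U → TorVanishes (n + j) U M := by
  rw [sSup_le_iff]
  constructor
  · intro h j hj U hU
    by_contra hT
    have : n + j ≤ n := by exact_mod_cast h _ ⟨n + j, ⟨U, hU, hT⟩, rfl⟩
    omega
  · rintro h _ ⟨k, ⟨U, hU, hT⟩, rfl⟩
    rcases le_or_gt k n with hk | hk
    · exact_mod_cast hk
    · obtain ⟨j, rfl⟩ := Nat.exists_eq_add_of_lt hk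
      exact absurd (h (j + 1) (Nat.succ_pos j) U hU) hT

theorem sSup_tor_eq_bot_iff {𝒰 : ModuleCat.{u} R → Prop} :
    sSup {m : WithBot ℕ∞ | ∃ k : ℕ, (∃ U, 𝒰 U ∧ ¬ TorVanishes k U M) ∧ m = k} = ⊥ ↔
      ∀ k U, 𝒰 U → TorVanishes k U M := by
  rw [sSup_eq_bot]
  constructor
  · intro h k U hU
    by_contra hT
    exact WithBot.coe_ne_bot (h _ ⟨k, ⟨U, hU, hT⟩, rfl⟩)
  · rintro h _ ⟨k, ⟨U, hU, hT⟩, -⟩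
    exact absurd (h k U hU) hT

theorem forall_torVanishes_iff {U : ModuleCat.{u} R} :
    (∀ j, 1 ≤ j → TorVanishes (n + j) U M) ↔ ∀ j, ExtZero M (charMod U) (n + j + 1) := by
  constructor
  · exact fun h j => torVanishes_succ_iff.1 (h (j + 1) (Nat.succ_pos j))
  · intro h j hj
    obtain ⟨j, rfl⟩ := Nat.exists_eq_succ_of_ne_zero (Nat.ne_of_gt hj)
    exact torVanishes_succ_iff.2 (h j)

variable (hC : IsSemidualizing C)
include hC

theorem projDim_isWFGorenstein_le_iff :
    projDim (IsWFGorenstein C) M ≤ n ↔ HasRes (IsWFGorenstein C) n M :=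
  projDim_le_iff (IsWFGorenstein.of_subsingleton hC) fun _ _ e h => h.congr e

variable (hR : IsGFClosed R)
include hR

theorem hasRes_iff_exists_at : HasRes (IsWFGorenstein C) n M ↔
    ∀ t : ℕ, t ≤ n → ∃ W : LeftSeq M, (∀ i, n < i → Subsingleton (W.X i)) ∧
      IsWFGorenstein C (W.X t) ∧ ∀ i, i ≤ n → i ≠ t → IsCFlat C (W.X i) := by
  constructor
  · intro h t ht
    obtain ⟨W, h0, hW⟩ := HasResP.exists_leftSeq (HasRes.exists_at hC hR h ht)
    exact ⟨W, h0, (hW t ht).1 rfl, fun i hi => (hW i hi).2⟩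
  · intro h
    -- For the converse the single case t = 0 is enough.
    obtain ⟨W, h0, ht, hW⟩ := h 0 (Nat.zero_le n)
    refine W.hasResP (fun _ _ _ e h => h.congr e) h0 fun i hi => ?_
    by_cases hi0 : i = 0
    · exact hi0 ▸ ht
    · exact (hW i hi hi0).isWFGorenstein hC

theorem hasRes_iff_exists_precover : HasRes (IsWFGorenstein C) n M ↔
    ∃ (K G : ModuleCat.{u} R) (f : K →ₗ[R] G) (g : G →ₗ[R] M),
      IsShortExact f g ∧ IsWFGorenstein C G ∧
      projDim (IsCFlat C) K + 1 ≤ (n : WithBot ℕ∞) := by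
  simp only [projDim_add_one_le_iff]
  constructor
  · intro h
    obtain ⟨K, G, hG, hK, f, g, hs⟩ := HasRes.exists_precover hC hR h
    exact ⟨K, G, f, g, hs, hG, hK⟩
  · rintro ⟨K, G, f, g, hs, hG, hK⟩
    exact HasResPred.hasRes hC ⟨f, g, hs⟩ hG hK

theorem hasRes_iff_exists_envelope : HasRes (IsWFGorenstein C) n M ↔
    ∃ (K' G' : ModuleCat.{u} R) (f : M →ₗ[R] K') (g : K' →ₗ[R] G'),
      IsShortExact f g ∧ IsWFGorenstein C G' ∧
      projDim (IsCFlat C) K' ≤ (n : WithBot ℕ∞) := by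
  simp only [projDim_le_iff (fun X _ => IsCFlat.of_subsingleton C X) fun _ _ e h => h.congr e]
  constructor
  · intro h
    obtain ⟨K, G, hG, hK, hs⟩ := HasRes.exists_precover hC hR h
    obtain ⟨K', G', hG', hK', f, g, hs'⟩ := HasResPred.exists_envelope hC hs hG hK
    exact ⟨K', G', f, g, hs', hG', hK'⟩
  · rintro ⟨K, G, f, g, hs, hG, hK⟩
    obtain ⟨K', G', hG', hK', hs'⟩ := HasRes.exists_precover_of_envelope hC hR ⟨f, g, hs⟩ hK hG
    exact HasResPred.hasRes hC hs' hG' hK'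

theorem hasRes_iff_exists_cProjective : HasRes (IsWFGorenstein C) n M ↔
    ∃ V : LeftSeq M, (∀ i, n < i → Subsingleton (V.X i)) ∧ IsWFGorenstein C (V.X n) ∧
      ∀ i, i < n → IsCProjective C (V.X i) := by
  constructor
  · intro h
    obtain ⟨V, h0, hV⟩ := HasResP.exists_leftSeq (HasRes.exists_cProjective hC hR h)
    exact ⟨V, h0, (hV n le_rfl).1 rfl, fun i hi => (hV i hi.le).2 hi⟩
  · rintro ⟨V, h0, hn, hV⟩
    refine V.hasResP (fun _ _ _ e h => h.congr e) h0 fun i hi => ?_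
    rcases hi.eq_or_lt with rfl | hi
    · exact hn
    · exact (hV i hi).isCFlat.isWFGorenstein hC

theorem HasRes.syzygy_isWFGorenstein (h : HasRes (IsWFGorenstein C) n M) (G : LeftSeq M)
    (h0 : ∀ i, n < i → Subsingleton (G.X i)) (hG : ∀ i, i < n → IsWFGorenstein C (G.X i)) :
    IsWFGorenstein C (G.X n) := by
  induction n generalizing M with
  | zero =>
    obtain ⟨e⟩ := G.nonempty_equiv (h0 1 one_pos)
    exact IsWFGorenstein.congr e.symm h
  | succ n ih =>
    exact ih (HasRes.syzygy hC hR G.ses (hG 0 (Nat.succ_pos n)) h) G.tail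
      (fun i hi => h0 (i + 1) (Nat.succ_lt_succ hi))
      fun i hi => hG (i + 1) (Nat.succ_lt_succ hi)

theorem hasRes_iff_forall_syzygy {m : ℕ} (hm : HasRes (IsWFGorenstein C) m M) :
    HasRes (IsWFGorenstein C) n M ↔
      ∀ G : LeftSeq M, (∀ i, n < i → Subsingleton (G.X i)) →
        (∀ i, i < n → IsWFGorenstein C (G.X i)) → IsWFGorenstein C (G.X n) := by
  refine ⟨fun h G h0 hG => HasRes.syzygy_isWFGorenstein hC hR h G h0 hG, fun h => ?_⟩
  -- Padding the known resolution to length n + m provides n steps in G(W_F); the hypothesis is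
  -- applied to the last kernel of this one sequence.
  obtain ⟨G, h0, hG⟩ := HasResP.exists_leftSeq (HasRes.truncate (n := n) (k := m)
    (hm.le (IsWFGorenstein.of_subsingleton hC) (Nat.le_add_left m n)))
  have hn := h G h0 fun i hi => hG i hi.le hi
  refine G.hasResP (fun _ _ _ e h => h.congr e) h0 fun i hi => ?_
  rcases hi.eq_or_lt with rfl | hi
  · exact hn
  · exact hG i hi.le hi

theorem hasRes_iff_torVanishes {m : ℕ} (hm : HasRes (IsWFGorenstein C) m M) :
    HasRes (IsWFGorenstein C) n M ↔ ∀ j : ℕ, 1 ≤ j → ∀ U : ModuleCat.{u} R,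
      IsCInjective C U → TorVanishes (n + j) U M := by
  constructor
  · exact fun h j hj U hU => forall_torVanishes_iff.2 (HasRes.extZero_charMod hC h hU) j hj
  · exact fun h => HasRes.of_extZero hC hR hm fun U hU =>
      forall_torVanishes_iff.1 fun j hj => h j hj U hU

omit hC hR in
theorem forall_torVanishes_isCInjective_iff :
    (∀ j : ℕ, 1 ≤ j → ∀ U : ModuleCat.{u} R, IsCInjective C U → TorVanishes (n + j) U M) ↔
    ∀ j : ℕ, 1 ≤ j → ∀ U : ModuleCat.{u} R, injDim (IsCInjective C) U < ⊤ →
      TorVanishes (n + j) U M := by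
  constructor
  · intro h j hj U hU
    obtain ⟨k, hk⟩ := exists_hasCores (fun _ _ e h => h.congr e) hU
    exact forall_torVanishes_iff.2 (hk.extZero_charMod fun V hV =>
      forall_torVanishes_iff.1 fun i hi => h i hi V hV) j hj
  · exact fun h j hj U hU => h j hj U (injDim_lt_top (IsCInjective.of_subsingleton C) hU)

/-- Vanishing in positive degrees puts M in G(W_F); vanishing in degree zero, U ⊗ M = 0 for all
C-injective U, then forces M = 0. -/
theorem projDim_isWFGorenstein_eq_bot_iff {m : ℕ} (hm : HasRes (IsWFGorenstein C) m M)
    {𝒰 : ModuleCat.{u} R → Prop}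
    (h𝒰 : ∀ U, IsCInjective C U → 𝒰 U) :
    projDim (IsWFGorenstein C) M = ⊥ ↔ ∀ k U, 𝒰 U → TorVanishes k U M := by
  rw [projDim_eq_bot_iff (IsWFGorenstein.of_subsingleton hC)]
  refine ⟨fun h k U _ => torVanishes_of_subsingleton h, fun h => ?_⟩
  have hM : HasRes (IsWFGorenstein C) 0 M := (hasRes_iff_torVanishes hC hR hm).2
    fun j _ U hU => h _ U (h𝒰 U hU)
  exact IsWFGorenstein.subsingleton hC hM fun U hU =>
    eq_zero_of_torVanishes_zero (h 0 U (h𝒰 U hU))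

end Main

end WFGorenstein

theorem theorem3p8 {R : Type u} [CommRing R] (hR : WFGorenstein.IsGFClosed R)
    (C : ModuleCat.{u} R) (hC : WFGorenstein.IsSemidualizing C)
    (M : ModuleCat.{u} R)
    (hM : WFGorenstein.projDim (WFGorenstein.IsWFGorenstein C) M < ⊤) :
    (∀ n : ℕ, List.TFAE [
      -- (1)
      WFGorenstein.projDim (WFGorenstein.IsWFGorenstein C) M ≤ (n : WithBot ℕ∞),
      -- (2)
      ∀ t : ℕ, t ≤ n → ∃ W : WFGorenstein.LeftSeq M,
        (∀ i, n < i → Subsingleton (W.X i)) ∧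
        WFGorenstein.IsWFGorenstein C (W.X t) ∧
        ∀ i, i ≤ n → i ≠ t → WFGorenstein.IsCFlat C (W.X i),
      -- (3), where `pd K ≤ n - 1` is written `pd K + 1 ≤ n`
      ∃ (K G : ModuleCat.{u} R) (f : K →ₗ[R] G) (g : G →ₗ[R] M),
        WFGorenstein.IsShortExact f g ∧ WFGorenstein.IsWFGorenstein C G ∧
        WFGorenstein.projDim (WFGorenstein.IsCFlat C) K + 1 ≤ (n : WithBot ℕ∞),
      -- (4)
      ∃ (K' G' : ModuleCat.{u} R) (f : M →ₗ[R] K') (g : K' →ₗ[R] G'),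
        WFGorenstein.IsShortExact f g ∧ WFGorenstein.IsWFGorenstein C G' ∧
        WFGorenstein.projDim (WFGorenstein.IsCFlat C) K' ≤ (n : WithBot ℕ∞),
      -- (5)
      ∃ V : WFGorenstein.LeftSeq M,
        (∀ i, n < i → Subsingleton (V.X i)) ∧
        WFGorenstein.IsWFGorenstein C (V.X n) ∧
        ∀ i, i < n → WFGorenstein.IsCProjective C (V.X i),
      -- (6)
      ∀ G : WFGorenstein.LeftSeq M,
        (∀ i, n < i → Subsingleton (G.X i)) →
        (∀ i, i < n → WFGorenstein.IsWFGorenstein C (G.X i)) →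
        WFGorenstein.IsWFGorenstein C (G.X n),
      -- (7)
      ∀ j : ℕ, 1 ≤ j → ∀ U : ModuleCat.{u} R, WFGorenstein.IsCInjective C U →
        WFGorenstein.TorVanishes (n + j) U M,
      -- (8)
      ∀ j : ℕ, 1 ≤ j → ∀ U : ModuleCat.{u} R,
        WFGorenstein.injDim (WFGorenstein.IsCInjective C) U < ⊤ →
        WFGorenstein.TorVanishes (n + j) U M]) ∧
    WFGorenstein.projDim (WFGorenstein.IsWFGorenstein C) M =
      sSup {m : WithBot ℕ∞ | ∃ n : ℕ, (∃ U : ModuleCat.{u} R,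
        WFGorenstein.IsCInjective C U ∧ ¬ WFGorenstein.TorVanishes n U M) ∧ m = n} ∧
    WFGorenstein.projDim (WFGorenstein.IsWFGorenstein C) M =
      sSup {m : WithBot ℕ∞ | ∃ n : ℕ, (∃ U : ModuleCat.{u} R,
        WFGorenstein.injDim (WFGorenstein.IsCInjective C) U < ⊤ ∧
        ¬ WFGorenstein.TorVanishes n U M) ∧ m = n} := by
  obtain ⟨m, hm⟩ := WFGorenstein.WithBot.enat_lt_top_iff.1 hM
  rw [WFGorenstein.projDim_isWFGorenstein_le_iff hC] at hm
  have h7 (n : ℕ) := WFGorenstein.hasRes_iff_torVanishes (n := n) hC hR hm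
  have h8 (n : ℕ) := (h7 n).trans WFGorenstein.forall_torVanishes_isCInjective_iff
  refine ⟨fun n => ?_, ?_, ?_⟩
  · rw [WFGorenstein.projDim_isWFGorenstein_le_iff hC]
    tfae_have 1 ↔ 2 := WFGorenstein.hasRes_iff_exists_at hC hR
    tfae_have 1 ↔ 3 := WFGorenstein.hasRes_iff_exists_precover hC hR
    tfae_have 1 ↔ 4 := WFGorenstein.hasRes_iff_exists_envelope hC hR
    tfae_have 1 ↔ 5 := WFGorenstein.hasRes_iff_exists_cProjective hC hR
    tfae_have 1 ↔ 6 := WFGorenstein.hasRes_iff_forall_syzygy hC hR hm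
    tfae_have 1 ↔ 7 := h7 n
    tfae_have 1 ↔ 8 := h8 n
    tfae_finish
  · refine WFGorenstein.WithBot.enat_eq_of_forall_le_iff ?_ fun n => ?_
    · rw [WFGorenstein.sSup_tor_eq_bot_iff]
      exact WFGorenstein.projDim_isWFGorenstein_eq_bot_iff hC hR hm fun _ hU => hU
    · rw [WFGorenstein.projDim_isWFGorenstein_le_iff hC, WFGorenstein.sSup_tor_le_iff, h7]
  · refine WFGorenstein.WithBot.enat_eq_of_forall_le_iff ?_ fun n => ?_
    · rw [WFGorenstein.sSup_tor_eq_bot_iff (𝒰 := fun U =>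
        WFGorenstein.injDim (WFGorenstein.IsCInjective C) U < ⊤)]
      exact WFGorenstein.projDim_isWFGorenstein_eq_bot_iff hC hR hm fun _ hU =>
        WFGorenstein.injDim_lt_top (WFGorenstein.IsCInjective.of_subsingleton C) hU
    · rw [WFGorenstein.projDim_isWFGorenstein_le_iff hC, WFGorenstein.sSup_tor_le_iff (𝒰 := fun U =>
        WFGorenstein.injDim (WFGorenstein.IsCInjective C) U < ⊤), h8]
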